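/- Let $(M,g,J)$ be a smooth almost Hermitian manifold of real dimension $2m$ with $m\ge 2$: $g$ is a Riemannian metric and $J$ a smooth almost complex structure with $g(JX,JY)=g(X,Y)$. Let $R(X,Y,Z,U)=g(R(X,Y)Z,U)$ be the curvature tensor of the Levi-Civita connection $\widetilde\nabla$ of $g$, where $R(X,Y)=[\widetilde\nabla_X,\widetilde\nabla_Y]-\widetilde\nabla_{[X,Y]}$. A subspace $\alpha\subset T_pM$ is called holomorphic if $J\alpha=\alpha$. For a submanifold $N$ of $M$ with Levi-Civita connection $\nabla$ of the induced metric, let $\alpha_N(x,y)=\widetilde\nabla_xy-\nabla_xy$ be its second fundamental form and $H=\frac{1}{\dim N}\operatorname{trace}\alpha_N$ its mean curvature vector; $N$ is totally geodesic if $\alpha_N=0$ and totally umbilical if $\alpha_N(x,y)=g(x,y)H$ for all tangent $x,y$; $H$ is parallel if the normal component of $\widetilde\nabla_xH$ vanishes for all tangent $x$. Let $1\le n<m$ and suppose that $M$ satisfies at least one of the following two axioms. (1) Axiom of holomorphic $2n$-planes: for each $p\in M$ and each $2n$-dimensional holomorphic subspace $\alpha$ of $T_pM$ there is a $2n$-dimensional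 totally geodesic submanifold $N$ containing $p$ with $T_pN=\alpha$. (2) Axiom of holomorphic $2n$-spheres: for each $p\in M$ and each $2n$-dimensional holomorphic subspace $\alpha$ of $T_pM$ there is a $2n$-dimensional totally umbilical submanifold $N$ with nonzero parallel mean curvature vector containing $p$ with $T_pN=\alpha$. Then $M$ is an $RK$-manifold, that is, $R(X,Y,Z,U)=R(JX,JY,JZ,JU)$ for all $p\in M$ and $X,Y,Z,U\in T_pM$, and $M$ has pointwise constant holomorphic sectional curvature: for each $p\in M$ the curvature $R(X,Y,Y,X)$ ($X,Y$ an orthonormal basis of $\alpha$) of a two-dimensional holomorphic subspace $\alpha\subset T_pM$ does not depend on $\alpha$. -/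

import Mathlib

open scoped Manifold ContDiff Bundle

noncomputable section

namespace AlmostHermitianGeometry

universe u

/-! ### Riemannian geometry in coordinates -/

section Coordinates

variable {E : Type*} [NormedAddCommGroup E] [NormedSpace ℝ E]
  {V : Type*} [NormedAddCommGroup V] [NormedSpace ℝ V]

/-- The Christoffel symbols of a metric `G` (given in coordinates), as a vector: `Γ_x(u, v)` is the
vector with
`G_x(Γ_x(u, v), w) = ½ (D_u G(v, w) + D_v G(u, w) - D_w G(u, v))` for all `w`,
so that the Levi-Civita connection is `∇_X Y = D_X Y + Γ(X, Y)`. The inverse of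
`G x : E →L[ℝ] (E →L[ℝ] ℝ)` raises the index. -/
def christoffel (G : E → E →L[ℝ] E →L[ℝ] ℝ) (x u v : E) : E :=
  (G x).inverse ((1 / 2 : ℝ) •
    (fderiv ℝ G x u v + fderiv ℝ G x v u - ((fderiv ℝ G x).flip u).flip v))

/-- The curvature `R(X, Y)Z = ∇_X ∇_Y Z - ∇_Y ∇_X Z - ∇_[X, Y] Z` of the Levi-Civita connection of
`G` at `x`, computed with the constant coordinate fields `X`, `Y`, `Z`. -/
def curvatureCoord (G : E → E →L[ℝ] E →L[ℝ] ℝ) (x X Y Z : E) : E :=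
  fderiv ℝ (fun y => christoffel G y Y Z) x X - fderiv ℝ (fun y => christoffel G y X Z) x Y
    + christoffel G x X (christoffel G x Y Z) - christoffel G x Y (christoffel G x X Z)

/-- The covariant derivative `∇_u W` at `y`, for the Levi-Civita connection of `G`, of a vector
field `W` along the map `F`. -/
def covDerivAlong (G : E → E →L[ℝ] E →L[ℝ] ℝ) (F : V → E) (W : V → E) (y u : V) : E :=
  fderiv ℝ W y u + christoffel G (F y) (fderiv ℝ F y u) (W y)

/-- The metric induced by `G` through `F` (the first fundamental form). -/
def inducedMetric (G : E → E →L[ℝ] E →L[ℝ] ℝ) (F : V → E) (y : V) : V →L[ℝ] V →L[ℝ] ℝ :=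
  (G (F y)).bilinearComp (fderiv ℝ F y) (fderiv ℝ F y)

/-- The second fundamental form `α(u, v) = ∇̃_u v - ∇_u v` of an immersion `F` at `y`, where `∇̃` is
the Levi-Civita connection of `G` and `∇` the one of the induced metric; `u` and `v` are constant
coordinate fields on the submanifold. -/
def secondFundamentalFormCoord (G : E → E →L[ℝ] E →L[ℝ] ℝ) (F : V → E) (y u v : V) : E :=
  covDerivAlong G F (fun z => fderiv ℝ F z v) y u
    - fderiv ℝ F y (christoffel (inducedMetric G F) y u v)

end Coordinates

/-! ### Riemannian manifolds -/

section Riemannian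

variable {E : Type*} [NormedAddCommGroup E] [NormedSpace ℝ E]
  {M : Type*} [TopologicalSpace M] [ChartedSpace E M] [IsManifold 𝓘(ℝ, E) ∞ M]

/-- A smooth Riemannian metric on the manifold `M`. -/
abbrev RiemannianMetricOn (E : Type*) [NormedAddCommGroup E] [NormedSpace ℝ E]
    (M : Type*) [TopologicalSpace M] [ChartedSpace E M] [IsManifold 𝓘(ℝ, E) ∞ M] :=
  Bundle.ContMDiffRiemannianMetric 𝓘(ℝ, E) ∞ E (fun x : M => TangentSpace 𝓘(ℝ, E) x)

/-- The metric `g` in the coordinates of the chart at `p₀`: the pullback of `g` under the inverse of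
that chart, `G_y(u, v) = g(Dφ⁻¹(y) u, Dφ⁻¹(y) v)`. -/
def metricInChart (g : RiemannianMetricOn E M) (p₀ : M) (y : E) : E →L[ℝ] E →L[ℝ] ℝ :=
  ContinuousLinearMap.bilinearComp (E := E) (F := E) (g.inner ((extChartAt 𝓘(ℝ, E) p₀).symm y))
    (mfderiv 𝓘(ℝ, E) 𝓘(ℝ, E) (extChartAt 𝓘(ℝ, E) p₀).symm y)
    (mfderiv 𝓘(ℝ, E) 𝓘(ℝ, E) (extChartAt 𝓘(ℝ, E) p₀).symm y)

/-- The coordinates of a tangent vector at `x` in the chart at `p₀`. -/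
def vecInChart (p₀ x : M) (v : TangentSpace 𝓘(ℝ, E) x) : E :=
  mfderiv 𝓘(ℝ, E) 𝓘(ℝ, E) (extChartAt 𝓘(ℝ, E) p₀) x v

/-- The curvature tensor `R(X, Y, Z, U) = g(R(X, Y)Z, U)` of `g` at `p`, computed in the chart
at `p`. -/
def riemannTensor (g : RiemannianMetricOn E M) (p : M) (X Y Z U : TangentSpace 𝓘(ℝ, E) p) : ℝ :=
  metricInChart g p (extChartAt 𝓘(ℝ, E) p p)
    (curvatureCoord (metricInChart g p) (extChartAt 𝓘(ℝ, E) p p)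
      (vecInChart p p X) (vecInChart p p Y) (vecInChart p p Z))
    (vecInChart p p U)

/-! ### Submanifolds

A submanifold of `M` is a manifold `N` together with an immersion `f : N → M`; this includes all
embedded submanifolds. Its extrinsic geometry is written in the charts of `N` at `q₀` and of `M` at
`f q₀`, at every point of the common domain of these charts and for every `q₀`. -/

variable {V : Type*} [NormedAddCommGroup V] [NormedSpace ℝ V]
  {N : Type*} [TopologicalSpace N] [ChartedSpace V N]

/-- The coordinate expression of `f : N → M` in the charts at `q₀` and `f q₀`. -/
def mapInCharts (E : Type*) [NormedAddCommGroup E] [NormedSpace ℝ E] [ChartedSpace E M]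
    (V : Type*) [NormedAddCommGroup V] [NormedSpace ℝ V] [ChartedSpace V N]
    (f : N → M) (q₀ : N) : V → E :=
  fun y => extChartAt 𝓘(ℝ, E) (f q₀) (f ((extChartAt 𝓘(ℝ, V) q₀).symm y))

/-- The set of coordinates where `mapInCharts` is meaningful. -/
def chartDomain (E : Type*) [NormedAddCommGroup E] [NormedSpace ℝ E] [ChartedSpace E M]
    (V : Type*) [NormedAddCommGroup V] [NormedSpace ℝ V] [ChartedSpace V N]
    (f : N → M) (q₀ : N) : Set V :=
  {y | y ∈ (extChartAt 𝓘(ℝ, V) q₀).target ∧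
    f ((extChartAt 𝓘(ℝ, V) q₀).symm y) ∈ (extChartAt 𝓘(ℝ, E) (f q₀)).source}

/-- The coordinate expression, in the charts at `q₀` and `f q₀`, of a field `H` of tangent vectors
of `M` along `f`. -/
def fieldInCharts (V : Type*) [NormedAddCommGroup V] [NormedSpace ℝ V] [ChartedSpace V N]
    (f : N → M) (H : ∀ q : N, TangentSpace 𝓘(ℝ, E) (f q)) (q₀ : N) : V → E :=
  fun y => vecInChart (f q₀) (f ((extChartAt 𝓘(ℝ, V) q₀).symm y))
    (H ((extChartAt 𝓘(ℝ, V) q₀).symm y))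

/-- `f : N → M` is totally geodesic: the second fundamental form vanishes identically. -/
def IsTotallyGeodesic (V : Type*) [NormedAddCommGroup V] [NormedSpace ℝ V] [ChartedSpace V N]
    (g : RiemannianMetricOn E M) (f : N → M) : Prop :=
  ∀ q₀ : N, ∀ y ∈ chartDomain E V f q₀, ∀ u v : V,
    secondFundamentalFormCoord (metricInChart g (f q₀)) (mapInCharts E V f q₀) y u v = 0

/-- `H` is a smooth normal vector field along `f : N → M`. -/
def IsNormalField (V : Type*) [NormedAddCommGroup V] [NormedSpace ℝ V] [ChartedSpace V N]
    (g : RiemannianMetricOn E M) (f : N → M)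
    (H : ∀ q : N, TangentSpace 𝓘(ℝ, E) (f q)) : Prop :=
  ContMDiff 𝓘(ℝ, V) 𝓘(ℝ, E).tangent ∞
      (fun q => (⟨f q, H q⟩ : TangentBundle 𝓘(ℝ, E) M)) ∧
    ∀ (q : N) (u : TangentSpace 𝓘(ℝ, V) q),
      g.inner (f q) (H q) (mfderiv 𝓘(ℝ, V) 𝓘(ℝ, E) f q u) = 0

/-- `f : N → M` is totally umbilical with mean curvature vector `H`: `α(x, y) = g(x, y) H` with `H`
normal. In positive dimension this identity forces `H = (1 / dim N) trace α`. -/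
def IsTotallyUmbilicalWith (V : Type*) [NormedAddCommGroup V] [NormedSpace ℝ V] [ChartedSpace V N]
    (g : RiemannianMetricOn E M) (f : N → M)
    (H : ∀ q : N, TangentSpace 𝓘(ℝ, E) (f q)) : Prop :=
  IsNormalField V g f H ∧
  ∀ q₀ : N, ∀ y ∈ chartDomain E V f q₀, ∀ u v : V,
    secondFundamentalFormCoord (metricInChart g (f q₀)) (mapInCharts E V f q₀) y u v =
      inducedMetric (metricInChart g (f q₀)) (mapInCharts E V f q₀) y u v •
        fieldInCharts V f H q₀ y

/-- The normal field `H` along `f : N → M` is parallel: the normal component `D_u H` of `∇̃_u H`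
vanishes, that is, `∇̃_u H` is orthogonal to all normal vectors `ζ`. -/
def IsParallelNormal (V : Type*) [NormedAddCommGroup V] [NormedSpace ℝ V] [ChartedSpace V N]
    (g : RiemannianMetricOn E M) (f : N → M)
    (H : ∀ q : N, TangentSpace 𝓘(ℝ, E) (f q)) : Prop :=
  ∀ q₀ : N, ∀ y ∈ chartDomain E V f q₀, ∀ (u : V) (ζ : E),
    (∀ w : V, metricInChart g (f q₀) (mapInCharts E V f q₀ y) ζ
      (fderiv ℝ (mapInCharts E V f q₀) y w) = 0) →
    metricInChart g (f q₀) (mapInCharts E V f q₀ y)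
      (covDerivAlong (metricInChart g (f q₀)) (mapInCharts E V f q₀)
        (fieldInCharts V f H q₀) y u) ζ = 0

/-- The submanifold `f : N → M` contains `p` and has there the tangent space `α`. -/
def PassesThroughWithTangent (V : Type*) [NormedAddCommGroup V] [NormedSpace ℝ V]
    [ChartedSpace V N] (f : N → M) (p : M) (α : Submodule ℝ (TangentSpace 𝓘(ℝ, E) p)) : Prop :=
  ∃ q : N, f q = p ∧ ∀ v : TangentSpace 𝓘(ℝ, E) p, v ∈ α ↔
    ∃ u : TangentSpace 𝓘(ℝ, V) q,
      tangentMap 𝓘(ℝ, V) 𝓘(ℝ, E) f (⟨q, u⟩ : TangentBundle 𝓘(ℝ, V) N) = ⟨p, v⟩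

end Riemannian

/-! ### Almost Hermitian manifolds -/

section Hermitian

/-- An almost Hermitian structure on the manifold `M`: a Riemannian metric `g` and a smooth almost
complex structure `J` which is orthogonal for `g`. -/
structure AlmostHermitianStructure (E : Type*) [NormedAddCommGroup E] [NormedSpace ℝ E]
    (M : Type*) [TopologicalSpace M] [ChartedSpace E M] [IsManifold 𝓘(ℝ, E) ∞ M] where
  /-- the Riemannian metric -/
  g : RiemannianMetricOn E M
  /-- the almost complex structure -/
  J : ∀ x : M, TangentSpace 𝓘(ℝ, E) x →L[ℝ] TangentSpace 𝓘(ℝ, E) x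
  smooth_J : ContMDiff 𝓘(ℝ, E) (𝓘(ℝ, E).prod 𝓘(ℝ, E →L[ℝ] E)) ∞
    (fun x => Bundle.TotalSpace.mk' (E →L[ℝ] E)
      (E := fun x : M => TangentSpace 𝓘(ℝ, E) x →L[ℝ] TangentSpace 𝓘(ℝ, E) x) x (J x))
  J_J : ∀ (x : M) (v : TangentSpace 𝓘(ℝ, E) x), J x (J x v) = -v
  compat : ∀ (x : M) (v w : TangentSpace 𝓘(ℝ, E) x), g.inner x (J x v) (J x w) = g.inner x v w

variable {E : Type*} [NormedAddCommGroup E] [NormedSpace ℝ E]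
  {M : Type u} [TopologicalSpace M] [ChartedSpace E M] [IsManifold 𝓘(ℝ, E) ∞ M]

/-- A subspace `α` of `T_pM` is holomorphic if `Jα = α`. -/
def IsHolomorphicSubspace (A : AlmostHermitianStructure E M) (p : M)
    (α : Submodule ℝ (TangentSpace 𝓘(ℝ, E) p)) : Prop :=
  α.map (A.J p).toLinearMap = α

/-- The axiom of holomorphic `2n`-planes: through every point, tangent to every `2n`-dimensional
holomorphic subspace, there is a `2n`-dimensional totally geodesic submanifold. -/
def AxiomOfHolomorphicPlanes (A : AlmostHermitianStructure E M) (n : ℕ) : Prop :=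
  ∀ (p : M) (α : Submodule ℝ (TangentSpace 𝓘(ℝ, E) p)),
    IsHolomorphicSubspace A p α → Module.finrank ℝ α = 2 * n →
    ∃ (N : Type u) (_ : TopologicalSpace N)
      (_ : ChartedSpace (EuclideanSpace ℝ (Fin (2 * n))) N)
      (_ : IsManifold (𝓡 (2 * n)) ∞ N) (f : N → M),
      Manifold.IsImmersion (𝓡 (2 * n)) 𝓘(ℝ, E) ∞ f ∧
      PassesThroughWithTangent (EuclideanSpace ℝ (Fin (2 * n))) f p α ∧
      IsTotallyGeodesic (EuclideanSpace ℝ (Fin (2 * n))) A.g f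

/-- The axiom of holomorphic `2n`-spheres: through every point, tangent to every `2n`-dimensional
holomorphic subspace, there is a `2n`-dimensional totally umbilical submanifold with nonzero
parallel mean curvature vector. -/
def AxiomOfHolomorphicSpheres (A : AlmostHermitianStructure E M) (n : ℕ) : Prop :=
  ∀ (p : M) (α : Submodule ℝ (TangentSpace 𝓘(ℝ, E) p)),
    IsHolomorphicSubspace A p α → Module.finrank ℝ α = 2 * n →
    ∃ (N : Type u) (_ : TopologicalSpace N)
      (_ : ChartedSpace (EuclideanSpace ℝ (Fin (2 * n))) N)
      (_ : IsManifold (𝓡 (2 * n)) ∞ N) (f : N → M),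
      Manifold.IsImmersion (𝓡 (2 * n)) 𝓘(ℝ, E) ∞ f ∧
      PassesThroughWithTangent (EuclideanSpace ℝ (Fin (2 * n))) f p α ∧
      ∃ H : ∀ q : N, TangentSpace 𝓘(ℝ, E) (f q),
        IsTotallyUmbilicalWith (EuclideanSpace ℝ (Fin (2 * n))) A.g f H ∧
        (∀ q : N, H q ≠ 0) ∧
        IsParallelNormal (EuclideanSpace ℝ (Fin (2 * n))) A.g f H

/-- `RK`-manifolds: the curvature tensor is `J`-invariant. -/
def IsRKManifold (A : AlmostHermitianStructure E M) : Prop :=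
  ∀ (p : M) (X Y Z U : TangentSpace 𝓘(ℝ, E) p),
    riemannTensor A.g p X Y Z U =
      riemannTensor A.g p (A.J p X) (A.J p Y) (A.J p Z) (A.J p U)

/-- Pointwise constant holomorphic sectional curvature: at each point `p`, the sectional curvature
`R(X, Y, Y, X)` (`X`, `Y` an orthonormal basis) of a holomorphic two-dimensional subspace of `T_pM`
does not depend on this subspace. -/
def HasPointwiseConstantHolomorphicCurvature (A : AlmostHermitianStructure E M) : Prop :=
  ∀ p : M, ∃ c : ℝ, ∀ α : Submodule ℝ (TangentSpace 𝓘(ℝ, E) p),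
    IsHolomorphicSubspace A p α → Module.finrank ℝ α = 2 →
    ∀ X ∈ α, ∀ Y ∈ α, A.g.inner p X X = 1 → A.g.inner p Y Y = 1 → A.g.inner p X Y = 0 →
      riemannTensor A.g p X Y Y X = c

end Hermitian

end AlmostHermitianGeometry

end

/-!
The Codazzi equation turns either axiom into a pointwise condition on the curvature tensor, and the
rest is linear algebra in a single tangent space.

Let `N` be totally geodesic, or totally umbilical with parallel mean curvature vector `h`. The Gauss
formula reads `∇̃_v F_w = F_*(∇_v w) + g(v, w) h`; differentiating it once more and using that `h` is
parallel and that `∇` is metric and torsion free, the normal component of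
`∇̃_u ∇̃_v F_w - ∇̃_v ∇̃_u F_w = R(F_u, F_v) F_w` vanishes (`codazzi`, `covDerivAlong_commutator`). So
`R(X, Y, Z, ξ) = 0` for `X`, `Y`, `Z` tangent to `N` and `ξ` normal. At the centre of a chart the
derivative of the chart is the identity, so the coordinate computation applies there directly
(`riemannTensor_eq_zero_of_submanifold`). Given `ξ` orthogonal to `X` and `JX`, the orthogonal
complement of `ξ`, `Jξ` has complex dimension at least `m - 1 ≥ n`, hence contains a holomorphic
`2n`-plane through `X` (`exists_invariant_orthogonal`). Therefore `R(X, JX, X, ξ) = 0` whenever `ξ` is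
orthogonal to `X` and `JX` (`preservesComplexLines_of_axioms`).

Polarizing this condition in the direction of `Y`, orthogonal to `X`, `JX` and of the same length,
gives
`R(Y, JX, JX, Y) + R(X, JY, JX, Y) + R(X, JX, JY, Y) = R(X, JX, JX, X)` (`polarized`). Comparing it
with the instance for `JX`, `JY` shows that the sectional curvatures are `J`-invariant, and a
curvature-like tensor is determined by its sectional curvatures (`J_invariant`). Exchanging `X` and
`Y` gives equal holomorphic sectional curvatures for `X` and `Y`, and expanding
`R(Z, JZ, JZ, Z)` for `Z = aX + bY` then shows that it is the constant multiple
`(a² + b²)² R(X, JX, JX, X)` (`holomorphic_add`, `holomorphic_const`).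
-/

noncomputable section

namespace AlmostHermitianGeometry

/-! ### Curvature-like tensors -/

section Algebra

variable {T : Type*} [AddCommGroup T] [Module ℝ T]

/-- A function of four vectors with the algebraic symmetries of a Riemann curvature tensor.
Linearity is only recorded in the first slot; the symmetries carry it over to the others. -/
structure IsCurvatureLike (R : T → T → T → T → ℝ) : Prop where
  add_left : ∀ X X' Y Z U, R (X + X') Y Z U = R X Y Z U + R X' Y Z U
  smul_left : ∀ (a : ℝ) X Y Z U, R (a • X) Y Z U = a * R X Y Z U
  swap_left : ∀ X Y Z U, R Y X Z U = -R X Y Z U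
  swap_right : ∀ X Y Z U, R X Y U Z = -R X Y Z U
  bianchi : ∀ X Y Z U, R X Y Z U + R Y Z X U + R Z X Y U = 0

namespace IsCurvatureLike

variable {R : T → T → T → T → ℝ}

theorem pair_symm (hR : IsCurvatureLike R) (X Y Z U : T) : R Z U X Y = R X Y Z U := by
  have h1 := hR.bianchi X Y Z U
  have h2 := hR.bianchi Y Z U X
  have h3 := hR.bianchi Z U X Y
  have h4 := hR.bianchi U X Y Z
  have a := hR.swap_left
  have b := hR.swap_right
  linarith [a X Y Z U, b X Y Z U, a Z U X Y, b Z U X Y, a Y Z X U, b Y Z X U, a X U Y Z, b X U Y Z,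
    a X U Z Y, a Z X Y U, b Z X Y U, a Y U X Z, b Y U X Z, a U Y X Z, b Y Z U X, a Y U Z X,
    b Z X U Y, a X Z U Y, b X Z U Y, b Y U Z X, b U Y X Z, b X Y U Z, b U X Y Z, b U X Z Y,
    b Z U Y X, a U X Y Z, a U X Z Y]

theorem add₂ (hR : IsCurvatureLike R) (X Y Y' Z U : T) :
    R X (Y + Y') Z U = R X Y Z U + R X Y' Z U := by
  rw [hR.swap_left, hR.add_left, hR.swap_left X Y, hR.swap_left X Y']; ring

theorem smul₂ (hR : IsCurvatureLike R) (a : ℝ) (X Y Z U : T) :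
    R X (a • Y) Z U = a * R X Y Z U := by
  rw [hR.swap_left, hR.smul_left, hR.swap_left X Y]; ring

theorem add₃ (hR : IsCurvatureLike R) (X Y Z Z' U : T) :
    R X Y (Z + Z') U = R X Y Z U + R X Y Z' U := by
  rw [← hR.pair_symm, hR.add_left, hR.pair_symm X Y, hR.pair_symm X Y]

theorem smul₃ (hR : IsCurvatureLike R) (a : ℝ) (X Y Z U : T) :
    R X Y (a • Z) U = a * R X Y Z U := by
  rw [← hR.pair_symm, hR.smul_left, hR.pair_symm X Y]

theorem add₄ (hR : IsCurvatureLike R) (X Y Z U U' : T) :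
    R X Y Z (U + U') = R X Y Z U + R X Y Z U' := by
  rw [← hR.pair_symm, hR.add₂, hR.pair_symm X Y, hR.pair_symm X Y]

theorem smul₄ (hR : IsCurvatureLike R) (a : ℝ) (X Y Z U : T) :
    R X Y Z (a • U) = a * R X Y Z U := by
  rw [← hR.pair_symm, hR.smul₂, hR.pair_symm X Y]

theorem neg₂ (hR : IsCurvatureLike R) (X Y Z U : T) : R X (-Y) Z U = -R X Y Z U := by
  simpa using hR.smul₂ (-1) X Y Z U

theorem neg₃ (hR : IsCurvatureLike R) (X Y Z U : T) : R X Y (-Z) U = -R X Y Z U := by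
  simpa using hR.smul₃ (-1) X Y Z U

theorem neg₄ (hR : IsCurvatureLike R) (X Y Z U : T) : R X Y Z (-U) = -R X Y Z U := by
  simpa using hR.smul₄ (-1) X Y Z U

theorem self_left (hR : IsCurvatureLike R) (X Z U : T) : R X X Z U = 0 := by
  linarith [hR.swap_left X X Z U]

theorem self_right (hR : IsCurvatureLike R) (X Y Z : T) : R X Y Z Z = 0 := by
  linarith [hR.swap_right X Y Z Z]

/-- A curvature-like tensor whose sectional curvatures all vanish is zero. -/
theorem eq_zero_of_sectional (hR : IsCurvatureLike R) (h : ∀ X Y, R X Y Y X = 0) (X Y Z U : T) :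
    R X Y Z U = 0 := by
  have h1 : ∀ X Y Z, R X Y Z X = 0 := fun X Y Z => by
    have e := h X (Y + Z)
    rw [hR.add₂, hR.add₃, hR.add₃, h, h] at e
    linarith [hR.pair_symm X Z Y X, hR.swap_left X Y Z X, hR.swap_right Y X Z X]
  have h2 : ∀ X Y Z U, R X Y Z U = -R U Y Z X := fun X Y Z U => by
    have e := h1 (X + U) Y Z
    rw [hR.add_left, hR.add₄, hR.add₄, h1, h1] at e
    linarith
  linarith [hR.bianchi X Y Z U, h2 X Y Z U, h2 Y Z X U, h2 Z X Y U, hR.swap_left X Y Z U,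
    hR.swap_left Y Z X U, hR.swap_left Z X Y U, hR.swap_right X Y Z U, hR.swap_right Y Z X U,
    hR.swap_right Z X Y U, hR.pair_symm X Y Z U, hR.pair_symm Y Z X U, hR.pair_symm Z X Y U,
    h2 Z U X Y, h2 X U Y Z, h2 Y U Z X, hR.swap_left Z U X Y, hR.swap_left X U Y Z,
    hR.swap_left Y U Z X, h2 U Y Z X, hR.swap_left U Y Z X, hR.swap_left U Z X Y,
    hR.swap_left U X Y Z]

end IsCurvatureLike

/-- A positive definite symmetric form `B` and a complex structure `J` orthogonal for `B`. -/
structure IsHermitianPair (B : T →ₗ[ℝ] T →ₗ[ℝ] ℝ) (J : T →ₗ[ℝ] T) : Prop where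
  symm : ∀ X Y, B X Y = B Y X
  pos : ∀ X, X ≠ 0 → 0 < B X X
  J_J : ∀ X, J (J X) = -X
  compat : ∀ X Y, B (J X) (J Y) = B X Y

/-- The component of `R(X, JX)X` orthogonal to the complex line of `X` vanishes, for all `X`. -/
def PreservesComplexLines (B : T →ₗ[ℝ] T →ₗ[ℝ] ℝ) (J : T →ₗ[ℝ] T)
    (R : T → T → T → T → ℝ) : Prop :=
  ∀ X ξ, B X ξ = 0 → B (J X) ξ = 0 → R X (J X) X ξ = 0

variable {B : T →ₗ[ℝ] T →ₗ[ℝ] ℝ} {J : T →ₗ[ℝ] T} {R : T → T → T → T → ℝ}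

namespace IsHermitianPair

theorem J_left (hJ : IsHermitianPair B J) (X Y : T) : B (J X) Y = -B X (J Y) := by
  rw [← hJ.compat X, hJ.J_J, map_neg, neg_neg]

theorem J_self (hJ : IsHermitianPair B J) (X : T) : B (J X) X = 0 := by
  linarith [hJ.J_left X X, hJ.symm X (J X)]

theorem self_J (hJ : IsHermitianPair B J) (X : T) : B X (J X) = 0 := by
  rw [hJ.symm, hJ.J_self]

/-- Orthogonal decomposition with respect to the complex line of `X`. -/
theorem exists_decomp (hJ : IsHermitianPair B J) {X : T} (hX : X ≠ 0) (Y : T) :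
    ∃ (a b : ℝ) (Y' : T), Y = a • X + b • J X + Y' ∧ B X Y' = 0 ∧ B (J X) Y' = 0 := by
  have h := (hJ.pos X hX).ne'
  refine ⟨B X Y / B X X, B (J X) Y / B X X,
    Y - (B X Y / B X X) • X - (B (J X) Y / B X X) • J X, by module, ?_, ?_⟩
  · simp only [map_sub, map_smul, smul_eq_mul, hJ.self_J]; field_simp; ring
  · simp only [map_sub, map_smul, smul_eq_mul, hJ.J_self, hJ.compat]; field_simp; ring

theorem exists_rescale (hJ : IsHermitianPair B J) {X Y : T} (hX : X ≠ 0) (hY : Y ≠ 0) :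
    ∃ a : ℝ, a ≠ 0 ∧ B (a • Y) (a • Y) = B X X := by
  have h1 := hJ.pos X hX
  have h2 := hJ.pos Y hY
  refine ⟨√(B X X / B Y Y), (Real.sqrt_pos.2 (div_pos h1 h2)).ne', ?_⟩
  simp only [map_smul, LinearMap.smul_apply, smul_eq_mul]
  rw [← mul_assoc, Real.mul_self_sqrt (div_pos h1 h2).le]
  field_simp

end IsHermitianPair

namespace PreservesComplexLines

theorem vanish (h : PreservesComplexLines B J R) (hR : IsCurvatureLike R)
    (hJ : IsHermitianPair B J) {X Y : T} (h1 : B X Y = 0) (h2 : B (J X) Y = 0) :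
    R X (J X) (J X) Y = 0 := by
  have := h (J X) Y h2 (by simp [hJ.J_J, h1])
  rwa [hJ.J_J, hR.neg₂, ← hR.swap_left] at this

/-- The coefficient of `t` in `R(S, JS, JS, D) = 0`, where `S = X + tY` and `D = tX - Y`. -/
theorem polarized (h : PreservesComplexLines B J R) (hR : IsCurvatureLike R)
    (hJ : IsHermitianPair B J) {X Y : T} (h1 : B X Y = 0) (h2 : B (J X) Y = 0)
    (h3 : B Y Y = B X X) :
    R Y (J X) (J X) Y + R X (J Y) (J X) Y + R X (J X) (J Y) Y = R X (J X) (J X) X := by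
  have h1' : B Y X = 0 := by rw [hJ.symm, h1]
  have h2' : B (J Y) X = 0 := by rw [hJ.J_left, hJ.symm, h2, neg_zero]
  have key : ∀ t : ℝ, R (X + t • Y) (J (X + t • Y)) (J (X + t • Y)) (t • X + -Y) = 0 := fun t =>
    h.vanish hR hJ
      (by simp only [map_add, map_smul, map_neg, LinearMap.add_apply, LinearMap.smul_apply,
            smul_eq_mul, h1, h1', h3]; ring)
      (by simp only [map_add, map_smul, map_neg, LinearMap.add_apply, LinearMap.smul_apply,
            smul_eq_mul, h2, h2', hJ.J_self]; ring)
  have z1 := h.vanish hR hJ h1 h2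
  have k1 := key 1
  have k2 := key (-1)
  have k3 := key 2
  have k4 := key (-2)
  -- a polynomial of degree four in `t`; four values and its vanishing constant term determine it
  simp only [map_add, map_smul, hR.add_left, hR.smul_left, hR.add₂, hR.smul₂, hR.add₃, hR.smul₃,
    hR.add₄, hR.smul₄, hR.neg₄] at k1 k2 k3 k4
  linarith

/-- The instances of `polarized` for `X`, `Y` and for `JX`, `JY` differ only in this term. -/
theorem sectional_J_swap (h : PreservesComplexLines B J R) (hR : IsCurvatureLike R)
    (hJ : IsHermitianPair B J) {X Y : T} (h1 : B X Y = 0) (h2 : B (J X) Y = 0)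
    (h3 : B Y Y = B X X) : R X (J Y) (J Y) X = R Y (J X) (J X) Y := by
  have e1 := h.polarized hR hJ h1 h2 h3
  have e2 := h.polarized hR hJ (X := J X) (Y := J Y) (by rw [hJ.compat, h1])
    (by rw [hJ.compat, h2]) (by rw [hJ.compat, hJ.compat, h3])
  simp only [hJ.J_J, hR.neg₂, hR.neg₃] at e2
  linarith [hR.pair_symm X (J Y) (J X) Y, hR.swap_left X (J X) Y (J Y),
    hR.swap_right X (J X) Y (J Y), hR.swap_left X (J X) X (J X), hR.swap_right X (J X) X (J X),
    hR.swap_left X (J Y) X (J Y), hR.swap_right X (J Y) X (J Y)]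

theorem sectional_J_of_orthogonal (h : PreservesComplexLines B J R) (hR : IsCurvatureLike R)
    (hJ : IsHermitianPair B J) {X Y : T} (hX : X ≠ 0) (h1 : B X Y = 0) (h2 : B (J X) Y = 0) :
    R (J X) (J Y) (J Y) (J X) = R X Y Y X := by
  rcases eq_or_ne Y 0 with rfl | hY
  · have e1 := hR.smul₂ 0 X 0 0 X
    have e2 := hR.smul₂ 0 (J X) 0 0 (J X)
    simp only [smul_zero, zero_mul] at e1 e2
    simp [e1, e2]
  obtain ⟨a, ha, hs⟩ := hJ.exists_rescale hX hY
  have e := h.sectional_J_swap hR hJ (X := X) (Y := J (a • Y))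
    (by simp [h2, ← neg_eq_iff_eq_neg.2 (hJ.J_left X Y)])
    (by simp [hJ.compat, h1]) (by rw [hJ.compat, hs])
  simp only [map_smul, hJ.J_J, smul_neg, hR.neg₂, hR.neg₃, neg_neg, hR.smul_left, hR.smul₂,
    hR.smul₃, hR.smul₄] at e
  have e' : R (J X) (J Y) (J Y) (J X) = R (J Y) (J X) (J X) (J Y) := by
    rw [hR.swap_left, hR.swap_right, neg_neg]
  rw [e']
  have ha2 : a * a ≠ 0 := mul_ne_zero ha ha
  exact mul_left_cancel₀ ha2 (by linarith)

/-- Sectional curvatures are `J`-invariant. -/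
theorem sectional_J (h : PreservesComplexLines B J R) (hR : IsCurvatureLike R)
    (hJ : IsHermitianPair B J) (X Y : T) :
    R (J X) (J Y) (J Y) (J X) = R X Y Y X := by
  rcases eq_or_ne X 0 with rfl | hX
  · have e1 := hR.smul_left 0 0 Y Y 0
    have e2 := hR.smul_left 0 0 (J Y) (J Y) 0
    simp only [smul_zero, zero_mul] at e1 e2
    simp [e1, e2]
  obtain ⟨a, b, Y', rfl, h1, h2⟩ := hJ.exists_decomp hX Y
  have e0 := h.sectional_J_of_orthogonal hR hJ hX h1 h2
  have e1 := h X Y' h1 h2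
  have e2 := h (J X) (J Y') (by rw [hJ.compat, h1]) (by rw [hJ.compat, h2])
  simp only [map_add, map_smul, hJ.J_J, hR.add₂, hR.add₃, hR.smul₂, hR.smul₃, hR.self_left,
    hR.self_right, hR.neg₂, hR.neg₃] at e2 ⊢
  have p1 := hR.pair_symm X (J X) Y' X
  have p2 := hR.pair_symm (J X) X (J Y') (J X)
  have s1 := hR.swap_right X (J X) X Y'
  have s2 := hR.swap_right (J X) X (J X) (J Y')
  have s3 := hR.swap_left Y' X X (J X)
  have s4 := hR.swap_right X Y' X (J X)
  have s5 := hR.swap_left (J Y') (J X) (J X) X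
  have s6 := hR.swap_right (J X) (J Y') (J X) X
  have s7 := hR.swap_left X (J X) X (J X)
  have s8 := hR.swap_right (J X) X X (J X)
  have s9 := hR.swap_right X (J X) X (J X)
  have z1 : R X (J X) Y' X = 0 := by linarith
  have z2 : R X Y' (J X) X = 0 := by linarith
  have z3 : R (J X) X (J Y') (J X) = 0 := by linarith
  have z4 : R (J X) (J Y') X (J X) = 0 := by linarith
  rw [z1, z2, z3, z4, e0]
  have z5 : R (J X) X X (J X) = R X (J X) (J X) X := by linarith
  rw [z5]
  ring

/-- The curvature is `J`-invariant, since a curvature-like tensor is determined by its sectional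
curvatures. -/
theorem J_invariant (h : PreservesComplexLines B J R) (hR : IsCurvatureLike R)
    (hJ : IsHermitianPair B J) (X Y Z U : T) : R X Y Z U = R (J X) (J Y) (J Z) (J U) := by
  have hS : IsCurvatureLike
      (fun X Y Z U => R X Y Z U + -R (J X) (J Y) (J Z) (J U)) := by
    constructor
    · intro X X' Y Z U; simp only [map_add, hR.add_left]; ring
    · intro a X Y Z U; simp only [map_smul, hR.smul_left]; ring
    · intro X Y Z U; rw [hR.swap_left X Y, hR.swap_left (J X)]; ring
    · intro X Y Z U; rw [hR.swap_right X Y, hR.swap_right (J X)]; ring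
    · intro X Y Z U
      linarith [hR.bianchi X Y Z U, hR.bianchi (J X) (J Y) (J Z) (J U)]
  have := hS.eq_zero_of_sectional (fun X Y => by simp [h.sectional_J hR hJ X Y]) X Y Z U
  linarith

/-- The holomorphic sectional curvature is a function of the complex line. -/
theorem holomorphic_line (hR : IsCurvatureLike R) (hJ : IsHermitianPair B J) (X : T) (a b : ℝ) :
    R (a • X + b • J X) (J (a • X + b • J X)) (J (a • X + b • J X)) (a • X + b • J X) =
      (a ^ 2 + b ^ 2) ^ 2 * R X (J X) (J X) X := by
  simp only [map_add, map_smul, hJ.J_J, hR.add_left, hR.smul_left, hR.add₂, hR.smul₂, hR.add₃,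
    hR.smul₃, hR.add₄, hR.smul₄, hR.neg₂, hR.neg₃, hR.self_left, hR.self_right]
  rw [hR.swap_left X (J X) X (J X), hR.swap_left X (J X) (J X) X, hR.swap_right X (J X) (J X) X]
  ring

/-- In the expansion, the terms with three equal arguments vanish by hypothesis, and the terms of
degree two in `X` and in `Y` sum to twice the left side of `polarized`. -/
theorem holomorphic_add (h : PreservesComplexLines B J R) (hR : IsCurvatureLike R)
    (hJ : IsHermitianPair B J) {X Y : T} (h1 : B X Y = 0) (h2 : B (J X) Y = 0)
    (h3 : B Y Y = B X X) (a b : ℝ) :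
    R (a • X + b • Y) (J (a • X + b • Y)) (J (a • X + b • Y)) (a • X + b • Y) =
      (a ^ 2 + b ^ 2) ^ 2 * R X (J X) (J X) X := by
  have h1' : B Y X = 0 := by rw [hJ.symm, h1]
  have h2' : B (J Y) X = 0 := by rw [hJ.J_left, hJ.symm, h2, neg_zero]
  have h4 : B X (J Y) = 0 := by linarith [hJ.J_left X Y]
  have h4' : B Y (J X) = 0 := by linarith [hJ.J_left Y X]
  have p := h.polarized hR hJ h1 h2 h3
  have q := h.polarized hR hJ h1' h2' h3.symm
  have r := h.sectional_J_swap hR hJ h1 h2 h3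
  have z1 := h.vanish hR hJ h1 h2
  have z2 := h.vanish hR hJ h1' h2'
  have z3 := h X (J Y) h4 (by rw [hJ.compat, h1])
  have z4 := h Y (J X) h4' (by rw [hJ.compat, h1'])
  simp only [map_add, map_smul, hR.add_left, hR.smul_left, hR.add₂, hR.smul₂, hR.add₃,
    hR.smul₃, hR.add₄, hR.smul₄]
  have w1 : R X (J X) (J Y) X = 0 := by rw [hR.swap_right, z3, neg_zero]
  have w2 : R Y (J Y) (J X) Y = 0 := by rw [hR.swap_right, z4, neg_zero]
  have w3 : R Y (J X) (J X) X = 0 := by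
    rw [← hR.pair_symm, hR.swap_left, hR.swap_right, neg_neg, z1]
  have w4 : R X (J Y) (J Y) Y = 0 := by
    rw [← hR.pair_symm, hR.swap_left, hR.swap_right, neg_neg, z2]
  have w5 : R X (J Y) (J X) X = 0 := by
    rw [← hR.pair_symm, hR.swap_left, z3, neg_zero]
  have w6 : R Y (J X) (J Y) Y = 0 := by
    rw [← hR.pair_symm, hR.swap_left, z4, neg_zero]
  have v1 : R Y (J Y) (J X) X = R X (J X) (J Y) Y := by
    rw [← hR.pair_symm, hR.swap_left, hR.swap_right, neg_neg]
  have v2 : R Y (J X) (J Y) X = R X (J Y) (J X) Y := by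
    rw [← hR.pair_symm, hR.swap_left, hR.swap_right, neg_neg]
  rw [v1, v2] at q
  have hH : R Y (J Y) (J Y) Y = R X (J X) (J X) X := by linarith
  rw [z1, z2, w1, w2, w3, w4, w5, w6, v1, v2, hH, r]
  linear_combination 2 * a ^ 2 * b ^ 2 * p

/-- The holomorphic sectional curvature `R(X, JX, JX, X) / |X|⁴` does not depend on `X`. -/
theorem holomorphic_const (h : PreservesComplexLines B J R) (hR : IsCurvatureLike R)
    (hJ : IsHermitianPair B J) {X Z : T} (hX : B X X = 1) (hZ : B Z Z = 1) :
    R Z (J Z) (J Z) Z = R X (J X) (J X) X := by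
  have hX0 : X ≠ 0 := by rintro rfl; simp at hX
  obtain ⟨a, b, Y, rfl, h1, h2⟩ := hJ.exists_decomp hX0 Z
  have h1' : B Y X = 0 := by rw [hJ.symm, h1]
  have h2' : B Y (J X) = 0 := by rw [hJ.symm, h2]
  have hN : a ^ 2 + b ^ 2 + B Y Y = 1 := by
    rw [← hZ]
    simp only [map_add, map_smul, LinearMap.add_apply, LinearMap.smul_apply, smul_eq_mul, h1, h2,
      h1', h2', hJ.compat, hX, hJ.J_self, hJ.self_J]
    ring
  rcases eq_or_ne Y 0 with rfl | hY
  · simp only [map_zero, add_zero] at hN ⊢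
    rw [holomorphic_line hR hJ, hN]; ring
  -- `Z = W + Y` with `W` on the complex line of `X`; `s • Y` and, below, `r • W` are unit vectors
  obtain ⟨s, hs0, hs⟩ := hJ.exists_rescale hX0 hY
  have hs2 : s ^ 2 * B Y Y = 1 := by
    rw [hX] at hs
    simp only [map_smul, LinearMap.smul_apply, smul_eq_mul] at hs
    linarith
  rcases eq_or_ne (a • X + b • J X) 0 with hW | hW
  · have hab : a ^ 2 + b ^ 2 = 0 := by
      have := congrArg (fun W => B W W) hW
      simp only [map_add, map_smul, LinearMap.add_apply, LinearMap.smul_apply, smul_eq_mul,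
        hJ.compat, hX, hJ.J_self, hJ.self_J, map_zero] at this
      linarith
    have hB : B Y Y = B X X := by linarith
    have e := h.holomorphic_add hR hJ h1 h2 hB 0 1
    simp only [zero_smul, one_smul, zero_add] at e
    rw [hW, zero_add, e]
    ring
  · obtain ⟨r, hr0, hr⟩ := hJ.exists_rescale (Y := a • X + b • J X) hX0 hW
    set W := a • X + b • J X with hWdef
    have hWW : B W W = a ^ 2 + b ^ 2 := by
      simp only [hWdef, map_add, map_smul, LinearMap.add_apply, LinearMap.smul_apply, smul_eq_mul,
        hJ.compat, hX, hJ.J_self, hJ.self_J]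
      ring
    have hr2 : r ^ 2 * (a ^ 2 + b ^ 2) = 1 := by
      rw [hX] at hr
      simp only [map_smul, LinearMap.smul_apply, smul_eq_mul, hWW] at hr
      linarith
    have e := h.holomorphic_add hR hJ (X := r • W) (Y := s • Y)
      (by simp [hWdef, h1, h2]) (by simp [hWdef, h1, h2, hJ.J_J]) (by rw [hs, hr]) r⁻¹ s⁻¹
    rw [smul_smul, smul_smul, inv_mul_cancel₀ hr0, inv_mul_cancel₀ hs0, one_smul, one_smul] at e
    rw [e]
    have e2 := holomorphic_line hR hJ X a b
    rw [← hWdef] at e2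
    simp only [map_smul, hR.smul_left, hR.smul₂, hR.smul₃, hR.smul₄]
    rw [e2]
    have i1 : r⁻¹ ^ 2 = a ^ 2 + b ^ 2 := by field_simp; linarith
    have i2 : s⁻¹ ^ 2 = B Y Y := by field_simp; linarith
    rw [i1, i2, hN]
    linear_combination (r ^ 2 * (a ^ 2 + b ^ 2) + 1) * R X (J X) (J X) X * hr2

/-- On an orthonormal basis of a complex line, the sectional curvature is that of `X`, `JX`. -/
theorem sectional_complex_line (hR : IsCurvatureLike R) (hJ : IsHermitianPair B J)
    {α : Submodule ℝ T} (hα : α.map J = α) (hd : Module.finrank ℝ α = 2) {X Y : T}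
    (hXα : X ∈ α) (hYα : Y ∈ α) (hX : B X X = 1) (hY : B Y Y = 1) (hXY : B X Y = 0) :
    R X Y Y X = R X (J X) (J X) X := by
  have hX0 : X ≠ 0 := by rintro rfl; simp at hX
  obtain ⟨a, b, Y', hYe, h1, h2⟩ := hJ.exists_decomp hX0 Y
  have hJα : J X ∈ α := hα ▸ Submodule.mem_map_of_mem hXα
  have hY' : Y' ∈ α := by
    have : Y' = Y - (a • X + b • J X) := by rw [hYe]; abel
    rw [this]
    exact α.sub_mem hYα (α.add_mem (α.smul_mem _ hXα) (α.smul_mem _ hJα))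
  -- three pairwise orthogonal vectors of the plane `α` cannot all be nonzero
  have hY0 : Y' = 0 := by
    by_contra hne
    have hp := hJ.pos Y' hne
    have : FiniteDimensional ℝ α := Module.finite_of_finrank_pos (by omega)
    have hli : LinearIndependent ℝ (![⟨X, hXα⟩, ⟨J X, hJα⟩, ⟨Y', hY'⟩] : Fin 3 → α) := by
      rw [Fintype.linearIndependent_iff]
      intro c hc
      have hc' : c 0 • X + c 1 • J X + c 2 • Y' = 0 := by
        have := congrArg (Submodule.subtype α) hc
        simpa [Fin.sum_univ_three] using this
      have c0 := congrArg (B X) hc'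
      have c1 := congrArg (B (J X)) hc'
      have c2 := congrArg (fun W => B W Y') hc'
      simp only [map_add, map_smul, LinearMap.add_apply, LinearMap.smul_apply, smul_eq_mul, h1, h2,
        hJ.compat, hX, hJ.J_self, hJ.self_J, map_zero, LinearMap.zero_apply] at c0 c1 c2
      have c2' : c 2 = 0 := by
        rcases mul_eq_zero.1 (by linarith : c 2 * B Y' Y' = 0) with h | h
        · exact h
        · exact absurd h hp.ne'
      intro i
      fin_cases i
      · simpa using c0
      · simpa using c1
      · simpa using c2'
    have := hli.fintype_card_le_finrank
    simp [hd] at this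
  subst hY0
  rw [add_zero] at hYe
  subst hYe
  have ha : a = 0 := by
    simpa [hX, hJ.self_J] using hXY
  subst ha
  have hb : b * b = 1 := by
    simpa [hJ.compat, hX] using hY
  simp only [zero_smul, zero_add, hR.smul₂, hR.smul₃]
  rw [← mul_assoc, hb, one_mul]

end PreservesComplexLines

/-! ### Holomorphic subspaces -/

theorem finrank_complex_line (hJ : IsHermitianPair B J) {X : T} (hX : X ≠ 0) :
    Module.finrank ℝ (Submodule.span ℝ {X, J X}) = 2 := by
  have hp := hJ.pos X hX
  have : LinearIndependent ℝ ![X, J X] := by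
    rw [LinearIndependent.pair_iff]
    intro s t h
    have c0 := congrArg (B X) h
    have c1 := congrArg (B (J X)) h
    simp only [map_add, map_smul, smul_eq_mul, hJ.compat, hJ.J_self, hJ.self_J, map_zero, mul_zero,
      add_zero, zero_add, mul_eq_zero, hp.ne', or_false] at c0 c1
    exact ⟨c0, c1⟩
  have e := finrank_span_eq_card this
  rwa [Matrix.range_cons_cons_empty, Fintype.card_fin] at e

theorem map_eq_of_invariant (hJ : IsHermitianPair B J) {α : Submodule ℝ T}
    (h : ∀ X ∈ α, J X ∈ α) : α.map J = α := by
  refine le_antisymm (Submodule.map_le_iff_le_comap.2 h) fun X hX => ?_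
  exact ⟨-J X, α.neg_mem (h X hX), by simp [hJ.J_J]⟩

/-- A `J`-invariant subspace `W` contains `J`-invariant subspaces through a given vector of every
even dimension between `2` and `dim W`. -/
theorem exists_invariant_between [FiniteDimensional ℝ T] (hJ : IsHermitianPair B J)
    {W : Submodule ℝ T} (hW : ∀ X ∈ W, J X ∈ W) {X : T} (hX : X ≠ 0) (hXW : X ∈ W) {n : ℕ}
    (hn : 1 ≤ n) (hd : 2 * n ≤ Module.finrank ℝ W) :
    ∃ α : Submodule ℝ T, α ≤ W ∧ X ∈ α ∧ (∀ Y ∈ α, J Y ∈ α) ∧ Module.finrank ℝ α = 2 * n := by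
  have hspan : ∀ Y, ∀ Z ∈ Submodule.span ℝ {Y, J Y}, J Z ∈ Submodule.span ℝ {Y, J Y} := by
    intro Y Z hZ
    rw [Submodule.mem_span_pair] at hZ ⊢
    obtain ⟨a, b, rfl⟩ := hZ
    exact ⟨-b, a, by simp only [map_add, map_smul, hJ.J_J]; module⟩
  have hle : ∀ Y ∈ W, Submodule.span ℝ {Y, J Y} ≤ W := by
    intro Y hY
    rw [Submodule.span_le]
    rintro Z (rfl | rfl)
    · exact hY
    · exact hW _ hY
  induction n, hn using Nat.le_induction with
  | base =>
    exact ⟨Submodule.span ℝ {X, J X}, hle X hXW, Submodule.subset_span (by simp), hspan X,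
      finrank_complex_line hJ hX⟩
  | succ n hn ih =>
    obtain ⟨α, hαW, hXα, hJα, hdα⟩ := ih (by omega)
    obtain ⟨Y, hYW, hYα⟩ : ∃ Y ∈ W, Y ∉ α := by
      by_contra hcon
      push Not at hcon
      have := Submodule.finrank_mono (show W ≤ α from hcon)
      omega
    have hY0 : Y ≠ 0 := by rintro rfl; exact hYα α.zero_mem
    refine ⟨α ⊔ Submodule.span ℝ {Y, J Y}, sup_le hαW (hle Y hYW), Submodule.mem_sup_left hXα,
      ?_, ?_⟩
    · intro Z hZ
      obtain ⟨Z₁, h1, Z₂, h2, rfl⟩ := Submodule.mem_sup.1 hZ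
      rw [map_add]
      exact Submodule.add_mem_sup (hJα _ h1) (hspan Y _ h2)
    · have hinf : α ⊓ Submodule.span ℝ {Y, J Y} = ⊥ := by
        rw [eq_bot_iff]
        rintro Z ⟨hZα, hZ⟩
        obtain ⟨a, b, rfl⟩ := Submodule.mem_span_pair.1 hZ
        have h1 := hJα _ hZα
        -- `(a - bJ)(a + bJ) Y = (a² + b²) Y`
        have h2 : (a ^ 2 + b ^ 2) • Y ∈ α := by
          have := α.sub_mem (α.smul_mem a hZα) (α.smul_mem b h1)
          convert! this using 1
          simp only [map_add, map_smul, hJ.J_J]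
          module
        have h3 : a ^ 2 + b ^ 2 = 0 := by
          by_contra hne
          exact hYα ((α.smul_mem_iff hne).1 h2)
        have ha : a = 0 := by nlinarith [sq_nonneg a, sq_nonneg b]
        have hb : b = 0 := by nlinarith [sq_nonneg a, sq_nonneg b]
        simp [ha, hb]
      have := Submodule.finrank_sup_add_finrank_inf_eq α (Submodule.span ℝ {Y, J Y})
      rw [hinf, finrank_bot, finrank_complex_line hJ hY0, hdα] at this
      omega

/-- Given `ξ` orthogonal to `X` and `JX`, the `2n`-dimensional holomorphic subspace through `X` is
found in the orthogonal complement of `ξ`, `Jξ`. -/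
theorem exists_invariant_orthogonal [FiniteDimensional ℝ T] (hJ : IsHermitianPair B J)
    {m n : ℕ} (hn : 1 ≤ n) (hnm : n < m) (hT : Module.finrank ℝ T = 2 * m) {X ξ : T} (hX : X ≠ 0)
    (h1 : B X ξ = 0) (h2 : B (J X) ξ = 0) :
    ∃ α : Submodule ℝ T, X ∈ α ∧ (∀ Y ∈ α, J Y ∈ α) ∧ Module.finrank ℝ α = 2 * n ∧
      ∀ Y ∈ α, B ξ Y = 0 := by
  let L : T →ₗ[ℝ] ℝ × ℝ := (B ξ).prod (B (J ξ))
  have hL : ∀ Y, Y ∈ LinearMap.ker L ↔ B ξ Y = 0 ∧ B (J ξ) Y = 0 := by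
    intro Y; simp [L]
  have hdim : 2 * n ≤ Module.finrank ℝ (LinearMap.ker L) := by
    have e1 := L.finrank_range_add_finrank_ker
    have e2 := Submodule.finrank_le (LinearMap.range L)
    rw [Module.finrank_prod, Module.finrank_self] at e2
    omega
  obtain ⟨α, hαL, hXα, hJα, hd⟩ := exists_invariant_between hJ (W := LinearMap.ker L)
    (fun Y hY => by
      rw [hL] at hY ⊢
      refine ⟨?_, by rw [hJ.compat, hY.1]⟩
      have := hJ.J_left ξ Y
      linarith [hY.2]) hX
    ((hL X).2 ⟨by rw [hJ.symm, h1], by rw [hJ.J_left, hJ.symm, h2, neg_zero]⟩) hn hdim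
  exact ⟨α, hXα, hJα, hd, fun Y hY => ((hL Y).1 (hαL hY)).1⟩

end Algebra

-- Mathlib's own setting, which instance search needs for maps into `E →L[ℝ] E →L[ℝ] E →L[ℝ] ℝ`
set_option maxSynthPendingDepth 3

/-! ### The Levi-Civita connection in coordinates -/

section Connection

open Filter Topology

variable {E : Type*} [NormedAddCommGroup E] [NormedSpace ℝ E]

theorem fderiv_bilin_apply {V F : Type*} [NormedAddCommGroup V] [NormedSpace ℝ V]
    [NormedAddCommGroup F] [NormedSpace ℝ F] {A : V → E →L[ℝ] E →L[ℝ] F} {y : V}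
    (hd : DifferentiableAt ℝ A y) (a b : E) (w : V) :
    fderiv ℝ (fun z => A z a b) y w = fderiv ℝ A y w a b := by
  rw [fderiv_clm_apply (by fun_prop) (by fun_prop), fderiv_clm_apply hd (by fun_prop)]
  simp

/-- `G` is, near `x`, a `C²` field of symmetric bilinear forms, nondegenerate at `x`. -/
structure IsMetricNear (G : E → E →L[ℝ] E →L[ℝ] ℝ) (x : E) : Prop where
  contDiffAt : ContDiffAt ℝ 2 G x
  symm : ∀ᶠ y in 𝓝 x, ∀ u v, G y u v = G y v u
  isInvertible : (G x).IsInvertible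

/-- The Christoffel symbols as a continuous bilinear map, which makes their dependence on the point
accessible to the differential calculus. -/
def christoffelCLM (G : E → E →L[ℝ] E →L[ℝ] ℝ) (x : E) : E →L[ℝ] E →L[ℝ] E :=
  (ContinuousLinearMap.compL ℝ E (E →L[ℝ] ℝ) E (G x).inverse) ∘L
    ((1 / 2 : ℝ) • (fderiv ℝ G x + (fderiv ℝ G x).flip -
      ((ContinuousLinearMap.flipₗᵢ ℝ E E ℝ).toContinuousLinearEquiv.toContinuousLinearMap ∘L
        (fderiv ℝ G x).flip)))

theorem christoffel_eq (G : E → E →L[ℝ] E →L[ℝ] ℝ) (x u v : E) :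
    christoffel G x u v = christoffelCLM G x u v := by
  simp [christoffel, christoffelCLM]

variable {G : E → E →L[ℝ] E →L[ℝ] ℝ} {x : E}

theorem fderiv_symm_of_eventually (hd : DifferentiableAt ℝ G x)
    (hs : ∀ᶠ y in 𝓝 x, ∀ u v, G y u v = G y v u) (w u v : E) :
    fderiv ℝ G x w u v = fderiv ℝ G x w v u := by
  rw [← fderiv_bilin_apply hd, ← fderiv_bilin_apply hd]
  have : (fun y => G y u v) =ᶠ[𝓝 x] fun y => G y v u := hs.mono fun y hy => hy u v
  rw [this.fderiv_eq]

namespace IsMetricNear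

theorem differentiableAt (h : IsMetricNear G x) : DifferentiableAt ℝ G x :=
  h.contDiffAt.differentiableAt (by norm_num)

theorem fderiv_symm (h : IsMetricNear G x) (w u v : E) :
    fderiv ℝ G x w u v = fderiv ℝ G x w v u :=
  fderiv_symm_of_eventually h.differentiableAt h.symm w u v

theorem eventually [CompleteSpace E] (h : IsMetricNear G x) : ∀ᶠ y in 𝓝 x, IsMetricNear G y := by
  have h3 : ∀ᶠ y in 𝓝 x, (G y).IsInvertible := by
    obtain ⟨e, he⟩ := h.isInvertible
    have := e.nhds
    rw [he] at this
    exact h.contDiffAt.continuousAt.eventually this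
  filter_upwards [h.contDiffAt.eventually (by simp), h.symm.eventually_nhds, h3] with y h1 h2 h3
  exact ⟨h1, h2, h3⟩

set_option synthInstance.maxHeartbeats 100000 in
theorem contDiffAt_christoffelCLM [CompleteSpace E] (h : IsMetricNear G x) :
    ContDiffAt ℝ 1 (christoffelCLM G) x := by
  have h1 : ContDiffAt ℝ 1 (fderiv ℝ G) x := h.contDiffAt.fderiv_right (by norm_num)
  have h2 : ContDiffAt ℝ 1 (fun y => (G y).inverse) x :=
    (h.isInvertible.contDiffAt_map_inverse (n := 1)).comp x (h.contDiffAt.of_le (by norm_num))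
  have h3 : ContDiffAt ℝ 1 (fun y => (fderiv ℝ G y).flip) x :=
    (ContinuousLinearMap.flipₗᵢ ℝ E E (E →L[ℝ] ℝ)).contDiff.contDiffAt.comp x h1
  unfold christoffelCLM
  exact ((ContinuousLinearMap.compL ℝ E (E →L[ℝ] ℝ) E).contDiff.contDiffAt.comp x h2).clm_comp
    (((h1.add h3).sub (contDiffAt_const.clm_comp h3)).const_smul _)

theorem differentiableAt_christoffelCLM [CompleteSpace E] (h : IsMetricNear G x) :
    DifferentiableAt ℝ (christoffelCLM G) x :=
  h.contDiffAt_christoffelCLM.differentiableAt (by norm_num)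

theorem christoffel_symm (h : IsMetricNear G x) (u v : E) :
    christoffelCLM G x u v = christoffelCLM G x v u := by
  rw [← christoffel_eq, ← christoffel_eq]
  unfold christoffel
  congr 2
  ext w
  simp only [sub_apply, add_apply,
    ContinuousLinearMap.flip_apply]
  rw [h.fderiv_symm w u v]
  ring

/-- The Levi-Civita connection is metric. -/
theorem fderiv_apply (h : IsMetricNear G x) (u v w : E) :
    fderiv ℝ G x u v w =
      G x (christoffelCLM G x u v) w + G x v (christoffelCLM G x u w) := by
  have h1 : ∀ a b c : E, G x (christoffelCLM G x a b) c =
      1 / 2 * (fderiv ℝ G x a b c + fderiv ℝ G x b a c - fderiv ℝ G x c a b) := fun a b c => by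
    rw [← christoffel_eq]
    unfold christoffel
    rw [h.isInvertible.self_apply_inverse]
    simp
  rw [h.symm.self_of_nhds v, h1, h1, h.fderiv_symm u w v, h.fderiv_symm v u w,
    h.fderiv_symm w u v]
  ring

end IsMetricNear

/-! ### The curvature tensor in coordinates -/

theorem curvatureCoord_eq [CompleteSpace E] (h : IsMetricNear G x) (X Y Z : E) :
    curvatureCoord G x X Y Z =
      fderiv ℝ (christoffelCLM G) x X Y Z - fderiv ℝ (christoffelCLM G) x Y X Z
        + christoffelCLM G x X (christoffelCLM G x Y Z)
        - christoffelCLM G x Y (christoffelCLM G x X Z) := by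
  have hd := h.differentiableAt_christoffelCLM
  simp only [curvatureCoord, christoffel_eq, fderiv_bilin_apply hd]

theorem IsMetricNear.fderiv_christoffelCLM_symm [CompleteSpace E] (h : IsMetricNear G x)
    (w u v : E) :
    fderiv ℝ (christoffelCLM G) x w u v = fderiv ℝ (christoffelCLM G) x w v u := by
  have hd := h.differentiableAt_christoffelCLM
  rw [← fderiv_bilin_apply hd, ← fderiv_bilin_apply hd]
  have : (fun y => christoffelCLM G y u v) =ᶠ[𝓝 x] fun y => christoffelCLM G y v u :=
    h.eventually.mono fun y hy => hy.christoffel_symm u v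
  rw [this.fderiv_eq]

/-- The derivative of the identity `∇G = 0`. -/
theorem IsMetricNear.fderiv_fderiv_apply [CompleteSpace E] (h : IsMetricNear G x)
    (X Y Z U : E) :
    fderiv ℝ (fderiv ℝ G) x X Y Z U =
      fderiv ℝ G x X (christoffelCLM G x Y Z) U + G x (fderiv ℝ (christoffelCLM G) x X Y Z) U
      + fderiv ℝ G x X Z (christoffelCLM G x Y U)
      + G x Z (fderiv ℝ (christoffelCLM G) x X Y U) := by
  have hd := h.differentiableAt_christoffelCLM
  have hG := h.differentiableAt
  have hG2 : DifferentiableAt ℝ (fderiv ℝ G) x :=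
    (h.contDiffAt.fderiv_right (m := 1) (by norm_num)).differentiableAt (by norm_num)
  have h1 : ∀ a b : E, HasFDerivAt (fun y => christoffelCLM G y a b)
      (((ContinuousLinearMap.apply ℝ E b) ∘L (ContinuousLinearMap.apply ℝ (E →L[ℝ] E) a)) ∘L
        fderiv ℝ (christoffelCLM G) x) x := fun a b =>
    (((ContinuousLinearMap.apply ℝ E b) ∘L
      (ContinuousLinearMap.apply ℝ (E →L[ℝ] E) a)).hasFDerivAt).comp x hd.hasFDerivAt
  have h2 : HasFDerivAt (fun y => fderiv ℝ G y Y Z U)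
      (((ContinuousLinearMap.apply ℝ ℝ U) ∘L (ContinuousLinearMap.apply ℝ (E →L[ℝ] ℝ) Z) ∘L
        (ContinuousLinearMap.apply ℝ (E →L[ℝ] E →L[ℝ] ℝ) Y)) ∘L fderiv ℝ (fderiv ℝ G) x) x :=
    (((ContinuousLinearMap.apply ℝ ℝ U) ∘L (ContinuousLinearMap.apply ℝ (E →L[ℝ] ℝ) Z) ∘L
        (ContinuousLinearMap.apply ℝ (E →L[ℝ] E →L[ℝ] ℝ) Y)).hasFDerivAt).comp x hG2.hasFDerivAt
  have h3 := (hG.hasFDerivAt.clm_apply (h1 Y Z)).clm_apply (hasFDerivAt_const U x)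
  have h4 := (hG.hasFDerivAt.clm_apply (hasFDerivAt_const Z x)).clm_apply (h1 Y U)
  have heq : (fun y => fderiv ℝ G y Y Z U) =ᶠ[𝓝 x]
      fun y => G y (christoffelCLM G y Y Z) U + G y Z (christoffelCLM G y Y U) :=
    h.eventually.mono fun y hy => hy.fderiv_apply Y Z U
  have h5 := (h2.congr_of_eventuallyEq heq.symm).unique (h3.add h4)
  have h6 := congrArg (fun L => L X) h5
  simp only [ContinuousLinearMap.comp_apply, ContinuousLinearMap.apply_apply,
    ContinuousLinearMap.comp_zero, ContinuousLinearMap.flip_add, add_apply, zero_add,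
    ContinuousLinearMap.flip_apply] at h6
  rw [h6]
  ring

/-- The classical symmetries of the curvature tensor of a metric. -/
theorem isCurvatureLike_curvatureCoord [CompleteSpace E] (h : IsMetricNear G x) :
    IsCurvatureLike (fun X Y Z U => G x (curvatureCoord G x X Y Z) U) := by
  constructor
  · intro X X' Y Z U
    simp only [curvatureCoord_eq h, map_add, map_sub, add_apply,
      sub_apply]
    ring
  · intro a X Y Z U
    simp only [curvatureCoord_eq h, map_add, map_sub, map_smul, add_apply,
      sub_apply, smul_apply, smul_eq_mul]
    ring
  · intro X Y Z U
    simp only [curvatureCoord_eq h, map_add, map_sub, add_apply,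
      sub_apply]
    ring
  · intro X Y Z U
    have hsym : IsSymmSndFDerivAt ℝ G x :=
      h.contDiffAt.isSymmSndFDerivAt (by simp)
    have e := congrArg (fun L => L Z U) (hsym.eq X Y)
    simp only [h.fderiv_fderiv_apply, h.fderiv_apply] at e
    simp only [curvatureCoord_eq h, map_add, map_sub, add_apply,
      sub_apply]
    have s := h.symm.self_of_nhds
    rw [s _ Z, s _ Z, s _ Z, s _ Z]
    linarith
  · intro X Y Z U
    simp only [curvatureCoord_eq h, map_add, map_sub, add_apply,
      sub_apply]
    rw [h.fderiv_christoffelCLM_symm X Z Y, h.fderiv_christoffelCLM_symm Y X Z,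
      h.fderiv_christoffelCLM_symm Z Y X, h.christoffel_symm Z Y, h.christoffel_symm X Z,
      h.christoffel_symm Y X]
    ring

end Connection

/-! ### The Codazzi equation -/

section Codazzi

open Filter Topology

variable {E : Type*} [NormedAddCommGroup E] [NormedSpace ℝ E]
  {V : Type*} [NormedAddCommGroup V] [NormedSpace ℝ V]
  {G : E → E →L[ℝ] E →L[ℝ] ℝ} {F : V → E} {y : V}

/-- The curvature of the connection pulled back by `F` is the pulled back curvature. -/
theorem covDerivAlong_commutator [CompleteSpace E] (hG : IsMetricNear G (F y))
    (hF : ContDiffAt ℝ 2 F y) {W : V → E} (hW : ContDiffAt ℝ 2 W y) (u v : V) :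
    covDerivAlong G F (fun z => covDerivAlong G F W z v) y u
      - covDerivAlong G F (fun z => covDerivAlong G F W z u) y v =
    curvatureCoord G (F y) (fderiv ℝ F y u) (fderiv ℝ F y v) (W y) := by
  have hF1 := (hF.differentiableAt (by norm_num)).hasFDerivAt
  have hW1 := (hW.differentiableAt (by norm_num)).hasFDerivAt
  have hF2 := ((hF.fderiv_right (m := 1) (by norm_num)).differentiableAt (by norm_num)).hasFDerivAt
  have hW2 := ((hW.fderiv_right (m := 1) (by norm_num)).differentiableAt (by norm_num)).hasFDerivAt
  have hΓ := hG.differentiableAt_christoffelCLM.hasFDerivAt.comp y hF1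
  have hder : ∀ a b : V, fderiv ℝ (fun z => covDerivAlong G F W z a) y b =
      fderiv ℝ (fderiv ℝ W) y b a
      + fderiv ℝ (christoffelCLM G) (F y) (fderiv ℝ F y b) (fderiv ℝ F y a) (W y)
      + christoffelCLM G (F y) (fderiv ℝ (fderiv ℝ F) y b a) (W y)
      + christoffelCLM G (F y) (fderiv ℝ F y a) (fderiv ℝ W y b) := by
    intro a b
    have h1 := hW2.clm_apply (hasFDerivAt_const a y)
    have h2 := (hΓ.clm_apply (hF2.clm_apply (hasFDerivAt_const a y))).clm_apply hW1
    have h3 := (h1.add h2).fderiv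
    have h4 : (fun z => covDerivAlong G F W z a) =
        (fun z => fderiv ℝ W z a) +
          fun z => (christoffelCLM G ∘ F) z (fderiv ℝ F z a) (W z) := by
      funext z
      simp [covDerivAlong, christoffel_eq]
    rw [h4, h3]
    simp
    abel
  have sF := (hF.isSymmSndFDerivAt (by simp)).eq u v
  have sW := (hW.isSymmSndFDerivAt (by simp)).eq u v
  rw [curvatureCoord_eq hG]
  simp only [covDerivAlong] at hder ⊢
  rw [hder, hder]
  simp only [christoffel_eq, map_add]
  rw [sF, sW]
  abel

theorem isInvertible_of_pos [FiniteDimensional ℝ V] {g : V →L[ℝ] V →L[ℝ] ℝ}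
    (h : ∀ u, u ≠ 0 → 0 < g u u) : g.IsInvertible := by
  have hinj : Function.Injective g.toLinearMap := by
    rw [← LinearMap.ker_eq_bot, LinearMap.ker_eq_bot']
    intro u hu
    by_contra hne
    have h1 := h u hne
    have h2 : g u = 0 := hu
    simp [h2] at h1
  have hdim : Module.finrank ℝ V = Module.finrank ℝ (V →L[ℝ] ℝ) := by
    rw [← (LinearMap.toContinuousLinearMap : (V →ₗ[ℝ] ℝ) ≃ₗ[ℝ] (V →L[ℝ] ℝ)).finrank_eq]
    exact (Subspace.dual_finrank_eq (K := ℝ) (V := V)).symm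
  exact ⟨(LinearEquiv.ofInjectiveOfFinrankEq g.toLinearMap hinj hdim).toContinuousLinearEquiv,
    by ext; rfl⟩

/-- The metric induced by an immersion is a metric. -/
theorem isMetricNear_inducedMetric [FiniteDimensional ℝ V] (hG : IsMetricNear G (F y))
    (hpos : ∀ e, e ≠ 0 → 0 < G (F y) e e) (hF : ContDiffAt ℝ 3 F y)
    (hinj : Function.Injective (fderiv ℝ F y)) : IsMetricNear (inducedMetric G F) y := by
  have hF1 : ContDiffAt ℝ 2 (fderiv ℝ F) y := hF.fderiv_right (by norm_num)
  refine ⟨?_, ?_, isInvertible_of_pos fun u hu => ?_⟩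
  · have h1 : ContDiffAt ℝ 2 (fun z => G (F z)) y :=
      hG.contDiffAt.comp y (hF.of_le (by norm_num))
    have h2 : ContDiffAt ℝ 2 (fun z => ((G (F z)).comp (fderiv ℝ F z)).flip) y :=
      (ContinuousLinearMap.flipₗᵢ ℝ V E ℝ).contDiff.contDiffAt.comp y (h1.clm_comp hF1)
    exact (ContinuousLinearMap.flipₗᵢ ℝ V V ℝ).contDiff.contDiffAt.comp y (h2.clm_comp hF1)
  · filter_upwards [hF.continuousAt.eventually hG.symm] with z hz u v
    simp [inducedMetric, hz _ (fderiv ℝ F z v)]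
  · have : fderiv ℝ F y u ≠ 0 := by
      rw [← map_zero (fderiv ℝ F y)]
      exact hinj.ne hu
    simpa [inducedMetric] using hpos _ this

/-- The Codazzi equation for a totally umbilical submanifold: if `α(v, w) = g(v, w) h` near `y` and
the normal component of `∇̃h` vanishes at `y`, then tangent vectors `X`, `Y`, `Z` have a tangent
`R(X, Y)Z`. -/
theorem codazzi [CompleteSpace E] [FiniteDimensional ℝ V] (hG : IsMetricNear G (F y))
    (hpos : ∀ e, e ≠ 0 → 0 < G (F y) e e) (hF : ContDiffAt ℝ 3 F y)
    (hinj : Function.Injective (fderiv ℝ F y)) {h : V → E} (hh : DifferentiableAt ℝ h y)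
    (hα : ∀ᶠ z in 𝓝 y, ∀ u v, secondFundamentalFormCoord G F z u v =
      inducedMetric G F z u v • h z)
    {ζ : E} (hζ : ∀ w, G (F y) (fderiv ℝ F y w) ζ = 0)
    (hpar : ∀ u, G (F y) (covDerivAlong G F h y u) ζ = 0) (u v w : V) :
    G (F y) (curvatureCoord G (F y) (fderiv ℝ F y u) (fderiv ℝ F y v) (fderiv ℝ F y w)) ζ = 0 := by
  have hg := isMetricNear_inducedMetric hG hpos hF hinj
  set g := inducedMetric G F with hgdef
  have hF1 : ContDiffAt ℝ 2 (fderiv ℝ F) y := hF.fderiv_right (by norm_num)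
  have hF2 := (hF1.differentiableAt (by norm_num)).hasFDerivAt
  -- the Gauss formula `∇̃_a F_b = F_*(∇_a b) + α(a, b)`
  have gauss : ∀ᶠ z in 𝓝 y, ∀ a b, covDerivAlong G F (fun z => fderiv ℝ F z b) z a =
      fderiv ℝ F z (christoffelCLM g z a b) + g z a b • h z := by
    filter_upwards [hα] with z hz a b
    rw [← hz a b, secondFundamentalFormCoord, christoffel_eq]
    abel
  have gauss0 := gauss.self_of_nhds
  -- the normal component of `∇̃_a ∇̃_b F_w`
  have key : ∀ a b : V,
      G (F y) (covDerivAlong G F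
        (fun z => covDerivAlong G F (fun z => fderiv ℝ F z w) z b) y a) ζ =
      (g y a (christoffelCLM g y b w) + fderiv ℝ g y a b w) * G (F y) (h y) ζ := by
    intro a b
    have heq : (fun z => covDerivAlong G F (fun z => fderiv ℝ F z w) z b) =ᶠ[𝓝 y]
        (fun z => fderiv ℝ F z (christoffelCLM g z b w) + g z b w • h z) :=
      gauss.mono fun z hz => hz b w
    have hc := (hg.differentiableAt_christoffelCLM.hasFDerivAt.clm_apply
      (hasFDerivAt_const b y)).clm_apply (hasFDerivAt_const w y)
    have hgb := (hg.differentiableAt.hasFDerivAt.clm_apply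
      (hasFDerivAt_const b y)).clm_apply (hasFDerivAt_const w y)
    have hd : HasFDerivAt (fun z => fderiv ℝ F z (christoffelCLM g z b w) + g z b w • h z) _ y :=
      (hF2.clm_apply hc).add (hgb.smul hh.hasFDerivAt)
    have hd' := congrArg (fun L => L a) hd.fderiv
    have hF3 := congrArg (fun L => L a)
      (hF2.clm_apply (hasFDerivAt_const (christoffelCLM g y b w) y)).fderiv
    have ga := gauss0 a (christoffelCLM g y b w)
    have hp := hpar a
    simp only [covDerivAlong, christoffel_eq] at ga hp heq ⊢
    have h0 := heq.self_of_nhds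
    dsimp only at h0
    rw [heq.fderiv_eq, h0]
    simp only [ContinuousLinearMap.comp_zero, zero_add, add_apply, ContinuousLinearMap.comp_apply,
      ContinuousLinearMap.flip_apply, smul_apply, ContinuousLinearMap.smulRight_apply] at hd'
    simp only [ContinuousLinearMap.comp_zero, zero_add, ContinuousLinearMap.flip_apply] at hF3
    rw [hd']
    rw [hF3] at ga
    have e1 := congrArg (fun e => G (F y) e ζ) ga
    simp only [map_add, map_smul, add_apply, smul_apply, smul_eq_mul, hζ] at e1 hp ⊢
    linear_combination e1 + g y b w * hp
  rw [← covDerivAlong_commutator hG (hF.of_le (by norm_num)) (W := fun z => fderiv ℝ F z w)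
    (hF1.clm_apply contDiffAt_const) u v, map_sub, sub_apply, key, key,
    hg.fderiv_apply, hg.fderiv_apply, hg.christoffel_symm v u,
    hg.symm.self_of_nhds v (christoffelCLM g y u w)]
  ring

end Codazzi

/-! ### Passage to charts -/

section Charts

open Filter Topology

variable {E : Type*} [NormedAddCommGroup E] [NormedSpace ℝ E]
  {M : Type*} [TopologicalSpace M] [ChartedSpace E M]

variable {V : Type*} [NormedAddCommGroup V] [NormedSpace ℝ V]
  {N : Type*} [TopologicalSpace N] [ChartedSpace V N]

theorem mapInCharts_self (f : N → M) (q : N) :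
    mapInCharts E V f q (extChartAt 𝓘(ℝ, V) q q) = extChartAt 𝓘(ℝ, E) (f q) (f q) := by
  rw [mapInCharts, extChartAt_to_inv]

theorem chartDomain_mem_nhds {f : N → M} (hf : Continuous f) (q : N) :
    chartDomain E V f q ∈ 𝓝 (extChartAt 𝓘(ℝ, V) q q) := by
  have h1 : ContinuousAt (fun y => f ((extChartAt 𝓘(ℝ, V) q).symm y))
      (extChartAt 𝓘(ℝ, V) q q) :=
    hf.continuousAt.comp (continuousAt_extChartAt_symm q)
  refine inter_mem (extChartAt_target_mem_nhds q) (h1.preimage_mem_nhds ?_)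
  rw [extChartAt_to_inv]
  exact extChartAt_source_mem_nhds (f q)

theorem contDiffAt_mapInCharts [IsManifold 𝓘(ℝ, V) ∞ N] {f : N → M}
    (hf : ContMDiff 𝓘(ℝ, V) 𝓘(ℝ, E) ∞ f) (q : N) :
    ContDiffAt ℝ ∞ (mapInCharts E V f q) (extChartAt 𝓘(ℝ, V) q q) := by
  have h1 : ContMDiffAt 𝓘(ℝ, V) 𝓘(ℝ, V) ∞ (extChartAt 𝓘(ℝ, V) q).symm
      (extChartAt 𝓘(ℝ, V) q q) :=
    (contMDiffOn_extChartAt_symm q).contMDiffAt (extChartAt_target_mem_nhds q)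
  have h2 : ContMDiffAt 𝓘(ℝ, V) 𝓘(ℝ, E) ∞
      (fun x => extChartAt 𝓘(ℝ, E) (f q) (f x)) q :=
    contMDiffAt_extChartAt.comp q (hf q)
  rw [← contMDiffAt_iff_contDiffAt]
  exact h2.comp_of_eq h1 (extChartAt_to_inv q)

theorem mfderiv_extChartAt_symm_eq_symmL [IsManifold 𝓘(ℝ, E) ∞ M] {p x : M}
    (hx : x ∈ (extChartAt 𝓘(ℝ, E) p).source) :
    mfderiv 𝓘(ℝ, E) 𝓘(ℝ, E) (extChartAt 𝓘(ℝ, E) p).symm (extChartAt 𝓘(ℝ, E) p x) =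
      (trivializationAt E (TangentSpace 𝓘(ℝ, E)) p).symmL ℝ x := by
  have : IsManifold 𝓘(ℝ, E) 1 M := .of_le (n := ∞) (by simp)
  rw [TangentBundle.symmL_trivializationAt (by simpa using hx)]
  rw [modelWithCornersSelf_coe, Set.range_id, mfderivWithin_univ]

theorem mfderiv_extChartAt_symm_self [IsManifold 𝓘(ℝ, E) ∞ M] (p : M) :
    mfderiv 𝓘(ℝ, E) 𝓘(ℝ, E) (extChartAt 𝓘(ℝ, E) p).symm (extChartAt 𝓘(ℝ, E) p p) =
      ContinuousLinearMap.id ℝ E := by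
  have : IsManifold 𝓘(ℝ, E) 1 M := .of_le (n := ∞) (by simp)
  have h := mfderivWithin_range_extChartAt_symm (I := 𝓘(ℝ, E)) (x := p)
  rwa [modelWithCornersSelf_coe, Set.range_id, mfderivWithin_univ] at h

variable [IsManifold 𝓘(ℝ, E) ∞ M]

theorem vecInChart_self (p : M) (v : TangentSpace 𝓘(ℝ, E) p) : vecInChart p p v = v := by
  have : IsManifold 𝓘(ℝ, E) 1 M := .of_le (n := ∞) (by simp)
  unfold vecInChart
  rw [mfderiv_extChartAt_self]
  rfl

theorem metricInChart_apply (g : RiemannianMetricOn E M) (p : M) (y u v : E) :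
    metricInChart g p y u v = g.inner ((extChartAt 𝓘(ℝ, E) p).symm y)
      (mfderiv 𝓘(ℝ, E) 𝓘(ℝ, E) (extChartAt 𝓘(ℝ, E) p).symm y u)
      (mfderiv 𝓘(ℝ, E) 𝓘(ℝ, E) (extChartAt 𝓘(ℝ, E) p).symm y v) := rfl

theorem metricInChart_self (g : RiemannianMetricOn E M) (p : M) (u v : TangentSpace 𝓘(ℝ, E) p) :
    metricInChart g p (extChartAt 𝓘(ℝ, E) p p) u v = g.inner p u v := by
  have base : ∀ x : M, x = p → ∀ a b : E, g.inner x a b = g.inner p a b := by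
    rintro _ rfl _ _
    rfl
  have e := mfderiv_extChartAt_symm_self (E := E) p
  exact (congrArg (fun A : E →L[ℝ] E =>
    (g.inner ((extChartAt 𝓘(ℝ, E) p).symm (extChartAt 𝓘(ℝ, E) p p)) (A u) (A v) : ℝ)) e).trans
      (base _ (extChartAt_to_inv p) _ _)

/-- The coefficients of the metric in the trivialization of the tangent bundle are smooth. -/
theorem contMDiffAt_inner_symmL (g : RiemannianMetricOn E M) {p x : M}
    (hx : x ∈ (extChartAt 𝓘(ℝ, E) p).source) (a b : E) :
    ContMDiffAt 𝓘(ℝ, E) 𝓘(ℝ) ∞ (fun x => g.inner x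
      ((trivializationAt E (TangentSpace 𝓘(ℝ, E)) p).symmL ℝ x a)
      ((trivializationAt E (TangentSpace 𝓘(ℝ, E)) p).symmL ℝ x b)) x := by
  have h (c : E) : ContMDiffAt 𝓘(ℝ, E) (𝓘(ℝ, E).prod 𝓘(ℝ, E)) ∞
      (fun x => Bundle.TotalSpace.mk' E (E := fun x : M => TangentSpace 𝓘(ℝ, E) x) x
        ((trivializationAt E (TangentSpace 𝓘(ℝ, E)) p).symmL ℝ x c)) x := by
    have h1 := (trivializationAt E (TangentSpace 𝓘(ℝ, E) : M → Type _) p).contMDiffAt_symmL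
      (IB := 𝓘(ℝ, E)) (n := ∞) (x := x) (by simpa using hx)
    have h2 : ContMDiffAt 𝓘(ℝ, E) (𝓘(ℝ, E).prod 𝓘(ℝ, E)) ∞
        (fun x => Bundle.TotalSpace.mk' E (E := fun x : M => Bundle.Trivial M E x) x c) x := by
      rw [Bundle.contMDiffAt_totalSpace]
      exact ⟨contMDiffAt_id, contMDiffAt_const⟩
    exact h1.clm_bundle_apply h2
  have h3 := (g.contMDiff x).clm_bundle_apply₂ (F₃ := ℝ) (E₃ := Bundle.Trivial M ℝ) (h a) (h b)
  exact (Bundle.contMDiffAt_totalSpace.1 h3).2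

theorem contDiffOn_metricInChart [FiniteDimensional ℝ E] (g : RiemannianMetricOn E M) (p : M) :
    ContDiffOn ℝ ∞ (metricInChart g p) (extChartAt 𝓘(ℝ, E) p).target := by
  rw [contDiffOn_clm_apply]
  intro a
  rw [contDiffOn_clm_apply]
  intro b y hy
  have hy' := (extChartAt 𝓘(ℝ, E) p).map_target hy
  have h1 := (contMDiffAt_inner_symmL g hy' a b).comp_contMDiffWithinAt y
    (contMDiffOn_extChartAt_symm (I := 𝓘(ℝ, E)) (n := ∞) p y hy)
  rw [contMDiffWithinAt_iff_contDiffWithinAt] at h1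
  refine h1.congr_of_mem (fun z hz => ?_) hy
  have hz' := (extChartAt 𝓘(ℝ, E) p).map_target hz
  have e := mfderiv_extChartAt_symm_eq_symmL hz'
  rw [(extChartAt 𝓘(ℝ, E) p).right_inv hz] at e
  exact congrArg (fun A : E →L[ℝ] E =>
    (g.inner ((extChartAt 𝓘(ℝ, E) p).symm z) (A a) (A b) : ℝ)) e

theorem metricInChart_pos (g : RiemannianMetricOn E M) (p : M) (e : E) (he : e ≠ 0) :
    0 < metricInChart g p (extChartAt 𝓘(ℝ, E) p p) e e := by
  rw [metricInChart_self g p e e]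
  exact g.pos p e he

theorem isMetricNear_metricInChart [FiniteDimensional ℝ E] (g : RiemannianMetricOn E M) (p : M) :
    IsMetricNear (metricInChart g p) (extChartAt 𝓘(ℝ, E) p p) where
  contDiffAt := ((contDiffOn_metricInChart g p).contDiffAt
    (extChartAt_target_mem_nhds p)).of_le (WithTop.coe_le_coe.2 (le_top : (2 : ℕ∞) ≤ ⊤))
  symm := Eventually.of_forall fun y u v => by
    rw [metricInChart_apply, metricInChart_apply, g.symm]
  isInvertible := isInvertible_of_pos (metricInChart_pos g p)

theorem riemannTensor_eq (g : RiemannianMetricOn E M) (p : M)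
    (X Y Z U : TangentSpace 𝓘(ℝ, E) p) :
    riemannTensor g p X Y Z U = metricInChart g p (extChartAt 𝓘(ℝ, E) p p)
      (curvatureCoord (metricInChart g p) (extChartAt 𝓘(ℝ, E) p p) X Y Z) U := by
  unfold riemannTensor
  rw [vecInChart_self, vecInChart_self, vecInChart_self, vecInChart_self]

theorem isCurvatureLike_riemannTensor [FiniteDimensional ℝ E] (g : RiemannianMetricOn E M)
    (p : M) : IsCurvatureLike (riemannTensor g p) := by
  have h := isCurvatureLike_curvatureCoord (isMetricNear_metricInChart g p)
  have e : riemannTensor g p = fun X Y Z U => metricInChart g p (extChartAt 𝓘(ℝ, E) p p)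
      (curvatureCoord (metricInChart g p) (extChartAt 𝓘(ℝ, E) p p) X Y Z) U := by
    funext X Y Z U
    exact riemannTensor_eq g p X Y Z U
  rw [e]
  exact ⟨h.add_left, h.smul_left, h.swap_left, h.swap_right, h.bianchi⟩

variable [IsManifold 𝓘(ℝ, V) ∞ N]

theorem fderiv_mapInCharts {f : N → M} (hf : ContMDiff 𝓘(ℝ, V) 𝓘(ℝ, E) ∞ f) (q : N)
    (w : TangentSpace 𝓘(ℝ, V) q) :
    fderiv ℝ (mapInCharts E V f q) (extChartAt 𝓘(ℝ, V) q q) w = mfderiv 𝓘(ℝ, V) 𝓘(ℝ, E) f q w := by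
  have : IsManifold 𝓘(ℝ, V) 1 N := .of_le (n := ∞) (by simp)
  have : IsManifold 𝓘(ℝ, E) 1 M := .of_le (n := ∞) (by simp)
  have h1 : MDifferentiableAt 𝓘(ℝ, V) 𝓘(ℝ, V) (extChartAt 𝓘(ℝ, V) q).symm
      (extChartAt 𝓘(ℝ, V) q q) :=
    ((contMDiffOn_extChartAt_symm (n := 1) q).contMDiffAt
      (extChartAt_target_mem_nhds q)).mdifferentiableAt (by simp)
  have h2 : MDifferentiableAt 𝓘(ℝ, E) 𝓘(ℝ, E) (extChartAt 𝓘(ℝ, E) (f q)) (f q) :=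
    contMDiffAt_extChartAt.mdifferentiableAt (n := 1) (by simp)
  have h3 : MDifferentiableAt 𝓘(ℝ, V) 𝓘(ℝ, E) f q := (hf q).mdifferentiableAt (by simp)
  have e1 := mfderiv_comp_of_eq (h2.comp q h3) h1 (extChartAt_to_inv q)
  have base : ∀ x : N, x = q → ∀ a : V,
      (mfderiv 𝓘(ℝ, V) 𝓘(ℝ, E) (extChartAt 𝓘(ℝ, E) (f q) ∘ f) x a : E) =
        mfderiv 𝓘(ℝ, V) 𝓘(ℝ, E) f q a := by
    rintro _ rfl a
    rw [mfderiv_comp _ h2 h3, mfderiv_extChartAt_self]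
    rfl
  rw [← mfderiv_eq_fderiv]
  have e2 := mfderiv_extChartAt_symm_self (E := V) q
  exact (congrArg (fun A : V →L[ℝ] E => A w) e1).trans
    ((base _ (extChartAt_to_inv q) _).trans
      (congrArg (fun A : V →L[ℝ] V => (mfderiv 𝓘(ℝ, V) 𝓘(ℝ, E) f q (A w) : E)) e2))

theorem differentiableAt_fieldInCharts {f : N → M} {H : ∀ q : N, TangentSpace 𝓘(ℝ, E) (f q)}
    (hH : ContMDiff 𝓘(ℝ, V) 𝓘(ℝ, E).tangent ∞
      (fun q => (⟨f q, H q⟩ : TangentBundle 𝓘(ℝ, E) M))) (hf : Continuous f) (q : N) :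
    DifferentiableAt ℝ (fieldInCharts V f H q) (extChartAt 𝓘(ℝ, V) q q) := by
  have : IsManifold 𝓘(ℝ, V) 1 N := .of_le (n := ∞) (by simp)
  have : IsManifold 𝓘(ℝ, E) 1 M := .of_le (n := ∞) (by simp)
  have h1 : MDifferentiableAt 𝓘(ℝ, V) 𝓘(ℝ, V) (extChartAt 𝓘(ℝ, V) q).symm
      (extChartAt 𝓘(ℝ, V) q q) :=
    ((contMDiffOn_extChartAt_symm (n := 1) q).contMDiffAt
      (extChartAt_target_mem_nhds q)).mdifferentiableAt (by simp)
  have h2 := ((Bundle.contMDiffAt_totalSpace.1 (hH q)).2).mdifferentiableAt (by simp)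
  have h3 := MDifferentiableAt.comp_of_eq _ h2 h1 (extChartAt_to_inv q)
  rw [mdifferentiableAt_iff_differentiableAt] at h3
  refine h3.congr_of_eventuallyEq ?_
  filter_upwards [chartDomain_mem_nhds (E := E) (V := V) hf q] with y hy
  have hy2 := hy.2
  rw [extChartAt_source] at hy2
  have e := TangentBundle.continuousLinearMapAt_trivializationAt (I := 𝓘(ℝ, E)) hy2
  unfold fieldInCharts vecInChart
  rw [← e]
  exact congrFun (Bundle.Trivialization.coe_linearMapAt_of_mem (R := ℝ)
    (trivializationAt E (TangentSpace 𝓘(ℝ, E)) (f q)) hy2) _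

/-- If, in charts around `q`, the second fundamental form is `g(v, w) h` with `h` parallel at `q` in
the normal bundle, then the curvature tensor maps tangent vectors to tangent vectors. -/
theorem riemannTensor_eq_zero_of_umbilical [FiniteDimensional ℝ E] [FiniteDimensional ℝ V]
    (g : RiemannianMetricOn E M) {f : N → M} (hf : ContMDiff 𝓘(ℝ, V) 𝓘(ℝ, E) ∞ f) (q : N)
    (hinj : Function.Injective (mfderiv 𝓘(ℝ, V) 𝓘(ℝ, E) f q)) {h : V → E}
    (hh : DifferentiableAt ℝ h (extChartAt 𝓘(ℝ, V) q q))
    (hα : ∀ y ∈ chartDomain E V f q, ∀ u v : V,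
      secondFundamentalFormCoord (metricInChart g (f q)) (mapInCharts E V f q) y u v =
        inducedMetric (metricInChart g (f q)) (mapInCharts E V f q) y u v • h y)
    (hpar : ∀ y ∈ chartDomain E V f q, ∀ (u : V) (ζ : E),
      (∀ w : V, metricInChart g (f q) (mapInCharts E V f q y) ζ
        (fderiv ℝ (mapInCharts E V f q) y w) = 0) →
      metricInChart g (f q) (mapInCharts E V f q y)
        (covDerivAlong (metricInChart g (f q)) (mapInCharts E V f q) h y u) ζ = 0)
    {ξ : TangentSpace 𝓘(ℝ, E) (f q)}
    (hξ : ∀ w, g.inner (f q) ξ (mfderiv 𝓘(ℝ, V) 𝓘(ℝ, E) f q w) = 0)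
    (u v w : TangentSpace 𝓘(ℝ, V) q) :
    riemannTensor g (f q) (mfderiv 𝓘(ℝ, V) 𝓘(ℝ, E) f q u) (mfderiv 𝓘(ℝ, V) 𝓘(ℝ, E) f q v)
      (mfderiv 𝓘(ℝ, V) 𝓘(ℝ, E) f q w) ξ = 0 := by
  have hd := fderiv_mapInCharts hf q
  have h0 := mapInCharts_self (E := E) (V := V) f q
  have hmem := chartDomain_mem_nhds (E := E) (V := V) hf.continuous q
  have hζ : ∀ w : V, metricInChart g (f q) (mapInCharts E V f q (extChartAt 𝓘(ℝ, V) q q)) ξ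
      (fderiv ℝ (mapInCharts E V f q) (extChartAt 𝓘(ℝ, V) q q) w) = 0 := fun w => by
    rw [h0, hd w]
    exact (metricInChart_self g (f q) _ _).trans (hξ w)
  have key := codazzi (G := metricInChart g (f q)) (F := mapInCharts E V f q)
    (y := extChartAt 𝓘(ℝ, V) q q) (h := h) (ζ := ξ)
    (by rw [h0]; exact isMetricNear_metricInChart g (f q))
    (by rw [h0]; exact metricInChart_pos g (f q))
    ((contDiffAt_mapInCharts hf q).of_le (WithTop.coe_le_coe.2 (le_top : (3 : ℕ∞) ≤ ⊤)))
    (fun a b hab => hinj (by rw [← hd a, ← hd b]; exact hab)) hh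
    (Filter.eventually_of_mem hmem hα)
    (fun w => by
      rw [← hζ w, h0]
      exact (isMetricNear_metricInChart g (f q)).symm.self_of_nhds _ _)
    (fun u => hpar _ (mem_of_mem_nhds hmem) u ξ hζ) u v w
  rw [riemannTensor_eq]
  rw [h0, hd u, hd v, hd w] at key
  exact key

end Charts

/-! ### Consequences of the axioms -/

section Axioms

variable {E : Type*} [NormedAddCommGroup E] [NormedSpace ℝ E]
  {M : Type*} [TopologicalSpace M] [ChartedSpace E M]
  {V : Type*} [NormedAddCommGroup V] [NormedSpace ℝ V]
  {N : Type*} [TopologicalSpace N] [ChartedSpace V N]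

/-- `α` is the range of the derivative of `f`; the transport `e ▸ α` moves it from `T_pM` to the equal
tangent space at `f q`, and disappears once `p` is replaced by `f q`. -/
theorem PassesThroughWithTangent.exists_range_eq {f : N → M} {p : M}
    {α : Submodule ℝ (TangentSpace 𝓘(ℝ, E) p)} (h : PassesThroughWithTangent V f p α) :
    ∃ q : N, ∃ e : f q = p,
      LinearMap.range (mfderiv 𝓘(ℝ, V) 𝓘(ℝ, E) f q).toLinearMap = e ▸ α := by
  obtain ⟨q, rfl, h⟩ := h
  refine ⟨q, rfl, ?_⟩
  ext v
  rw [h v, LinearMap.mem_range]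
  refine exists_congr fun u => ?_
  simp [tangentMap]

variable [IsManifold 𝓘(ℝ, E) ∞ M]

/-- The metric on `T_pM` as a bilinear form. -/
def metricForm (g : RiemannianMetricOn E M) (p : M) :
    TangentSpace 𝓘(ℝ, E) p →ₗ[ℝ] TangentSpace 𝓘(ℝ, E) p →ₗ[ℝ] ℝ :=
  LinearMap.mk₂ ℝ (fun X Y => g.inner p X Y) (by simp) (by simp) (by simp) (by simp)

theorem isHermitianPair (A : AlmostHermitianStructure E M) (p : M) :
    IsHermitianPair (metricForm A.g p) (A.J p).toLinearMap where
  symm := A.g.symm p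
  pos := A.g.pos p
  J_J := A.J_J p
  compat := A.compat p

/-- The curvature maps the tangent vectors of `α` to `α` if there is, through `p` and tangent to
`α`, a totally geodesic submanifold, or a totally umbilical one with parallel mean curvature. -/
theorem riemannTensor_eq_zero_of_submanifold [FiniteDimensional ℝ E] [FiniteDimensional ℝ V]
    [IsManifold 𝓘(ℝ, V) ∞ N] (g : RiemannianMetricOn E M) {f : N → M}
    (hf : ContMDiff 𝓘(ℝ, V) 𝓘(ℝ, E) ∞ f) {p : M} {α : Submodule ℝ (TangentSpace 𝓘(ℝ, E) p)}
    (hα : PassesThroughWithTangent V f p α) (hdim : Module.finrank ℝ α = Module.finrank ℝ V)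
    (hN : IsTotallyGeodesic V g f ∨ ∃ H : ∀ q : N, TangentSpace 𝓘(ℝ, E) (f q),
      IsTotallyUmbilicalWith V g f H ∧ IsParallelNormal V g f H)
    {ξ : TangentSpace 𝓘(ℝ, E) p} (hξ : ∀ X ∈ α, g.inner p ξ X = 0)
    {X Y Z : TangentSpace 𝓘(ℝ, E) p} (hX : X ∈ α) (hY : Y ∈ α) (hZ : Z ∈ α) :
    riemannTensor g p X Y Z ξ = 0 := by
  obtain ⟨q, rfl, hr⟩ := hα.exists_range_eq
  dsimp only at hr
  subst hr
  have hinj : Function.Injective (mfderiv 𝓘(ℝ, V) 𝓘(ℝ, E) f q) := by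
    have : FiniteDimensional ℝ (TangentSpace 𝓘(ℝ, V) q) := inferInstanceAs (FiniteDimensional ℝ V)
    have e := (mfderiv 𝓘(ℝ, V) 𝓘(ℝ, E) f q).toLinearMap.finrank_range_add_finrank_ker
    have e' : Module.finrank ℝ (TangentSpace 𝓘(ℝ, V) q) = Module.finrank ℝ V := rfl
    have e2 : Module.finrank ℝ
      (LinearMap.ker (mfderiv 𝓘(ℝ, V) 𝓘(ℝ, E) f q).toLinearMap) = 0 := by omega
    exact LinearMap.ker_eq_bot.1 (Submodule.finrank_eq_zero.1 e2)
  obtain ⟨u, rfl⟩ := hX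
  obtain ⟨v, rfl⟩ := hY
  obtain ⟨w, rfl⟩ := hZ
  have hξ' : ∀ w, g.inner (f q) ξ (mfderiv 𝓘(ℝ, V) 𝓘(ℝ, E) f q w) = 0 := fun w => hξ _ ⟨w, rfl⟩
  rcases hN with hN | ⟨H, ⟨⟨hH, -⟩, hN⟩, hpar⟩
  · refine riemannTensor_eq_zero_of_umbilical g hf q hinj (h := fun _ => 0) (by fun_prop)
      (fun y hy u v => ?_) (fun y hy u ζ _ => ?_) hξ' u v w
    · rw [hN q y hy, smul_zero]
    · simp [covDerivAlong, christoffel_eq]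
  · exact riemannTensor_eq_zero_of_umbilical g hf q hinj
      (differentiableAt_fieldInCharts hH hf.continuous q) (hN q) (hpar q) hξ' u v w

end Axioms

/-- Either axiom forces the curvature to preserve complex lines. -/
theorem preservesComplexLines_of_axioms {m n : ℕ} (hn : 1 ≤ n) (hnm : n < m)
    {M : Type*} [TopologicalSpace M] [ChartedSpace (EuclideanSpace ℝ (Fin (2 * m))) M]
    [IsManifold (𝓡 (2 * m)) ∞ M]
    (A : AlmostHermitianStructure (EuclideanSpace ℝ (Fin (2 * m))) M)
    (h : AxiomOfHolomorphicPlanes A n ∨ AxiomOfHolomorphicSpheres A n) (p : M) :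
    PreservesComplexLines (metricForm A.g p) (A.J p).toLinearMap (riemannTensor A.g p) := by
  intro X ξ h1 h2
  have hJ := isHermitianPair A p
  rcases eq_or_ne X 0 with rfl | hX
  · simpa using (isCurvatureLike_riemannTensor A.g p).smul_left 0 0 (A.J p 0) 0 ξ
  have : FiniteDimensional ℝ (TangentSpace (𝓡 (2 * m)) p) :=
    inferInstanceAs (FiniteDimensional ℝ (EuclideanSpace ℝ (Fin (2 * m))))
  have hT : Module.finrank ℝ (TangentSpace (𝓡 (2 * m)) p) = 2 * m :=
    finrank_euclideanSpace_fin (𝕜 := ℝ)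
  obtain ⟨α, hXα, hJα, hd, hξ⟩ := exists_invariant_orthogonal hJ hn hnm hT hX h1 h2
  have hdim : Module.finrank ℝ α = Module.finrank ℝ (EuclideanSpace ℝ (Fin (2 * n))) := by
    rw [hd, finrank_euclideanSpace_fin]
  have hol : IsHolomorphicSubspace A p α := map_eq_of_invariant hJ hJα
  rcases h with h | h
  · obtain ⟨N, _, _, _, f, ⟨_, _, _, hf⟩, hpass, hN⟩ := h p α hol hd
    exact riemannTensor_eq_zero_of_submanifold A.g hf.contMDiff hpass hdim (Or.inl hN) hξ hXα
      (hJα X hXα) hXα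
  · obtain ⟨N, _, _, _, f, ⟨_, _, _, hf⟩, hpass, H, hN, -, hpar⟩ := h p α hol hd
    exact riemannTensor_eq_zero_of_submanifold A.g hf.contMDiff hpass hdim
      (Or.inr ⟨H, hN, hpar⟩) hξ hXα (hJα X hXα) hXα

end AlmostHermitianGeometry

end

theorem theorem1 (m n : ℕ) (hm : 2 ≤ m) (hn : 1 ≤ n) (hnm : n < m)
    {M : Type*} [TopologicalSpace M] [ChartedSpace (EuclideanSpace ℝ (Fin (2 * m))) M]
    [IsManifold (𝓡 (2 * m)) ∞ M]
    (A : AlmostHermitianGeometry.AlmostHermitianStructure (EuclideanSpace ℝ (Fin (2 * m))) M)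
    (h : AlmostHermitianGeometry.AxiomOfHolomorphicPlanes A n ∨
      AlmostHermitianGeometry.AxiomOfHolomorphicSpheres A n) :
    AlmostHermitianGeometry.IsRKManifold A ∧
      AlmostHermitianGeometry.HasPointwiseConstantHolomorphicCurvature A := by
  open AlmostHermitianGeometry in
  have hline := preservesComplexLines_of_axioms hn hnm A h
  have hR := fun p => isCurvatureLike_riemannTensor A.g p
  have hJ := fun p => isHermitianPair A p
  refine ⟨fun p X Y Z U => (hline p).J_invariant (hR p) (hJ p) X Y Z U, fun p => ?_⟩
  by_cases hunit : ∃ X₀ : TangentSpace (𝓡 (2 * m)) p, A.g.inner p X₀ X₀ = 1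
  · obtain ⟨X₀, hX₀⟩ := hunit
    refine ⟨riemannTensor A.g p X₀ (A.J p X₀) (A.J p X₀) X₀, fun α hα hd X hX Y hY h1 h2 h3 => ?_⟩
    rw [PreservesComplexLines.sectional_complex_line (hR p) (hJ p) hα hd hX hY h1 h2 h3]
    exact (hline p).holomorphic_const (hR p) (hJ p) hX₀ h1
  -- without unit vectors, that is, when `T_pM = 0`, there is nothing to prove
  · exact ⟨0, fun α _ _ X _ _ _ h1 => absurd ⟨X, h1⟩ hunit⟩
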